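/- **Setting.** Let $K,T\in\mathbb N$, $\lambda>0$, $L\in\mathbb R$, and let $p_1,\dots,p_K:[0,1]\to[0,1]$ satisfy $|p_j(c)-p_j(c')|\le L|c-c'|$ for all $c,c'\in[0,1]$. Let $y_1,y_2,\dots\in\{-1,1\}$ be an arbitrary deterministic sequence of labels. In round $t=1,\dots,T$ the learner, knowing $\mathcal F_t$ (all expert predictions, labels and internal randomization of the previous rounds), chooses payments $c_{t,1},\dots,c_{t,K}$; then the experts reveal predictions $Z_{t,1},\dots,Z_{t,K}\in\{-1,1\}$ which, conditionally on $\mathcal F_t$, are independent with $\Pr(Z_{t,j}=y_t\mid\mathcal F_t)=p_j(c_{t,j})$; the learner predicts $\hat y_t\in\{-1,1\}$, and finally $y_t$ is revealed. Put $\Phi(q)=\exp\bigl(-2\sum_{j=1}^K(\tfrac12-q_j)^2\bigr)$ and $p(c)=(p_1(c_1),\dots,p_K(c_K))$. **Algorithm (LCB-GAPTRON).** Input: a finite set $\mathcal C\subset[0,1]$ of $N=|\mathcal C|$ costs, and $\beta\ge0$, $\delta>0$. Let $\mathrm{sign}$ take values in $\{-1,1\}$, with $\mathrm{sign}(0)=1$.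 For $c\in\mathcal C$ let $n_{t,j}(c)=\sum_{s<t}\mathbb 1[c_{s,j}=c]$. If $n_{t,j}(c)=0$ put $\hat p_{t,j}(c)=1$, $\alpha_{t,j}(c)=\tfrac12$, $\mathcal P_{t,j}(c)=1$; otherwise, writing $n=n_{t,j}(c)$ and $\hat p=\hat p_{t,j}(c)$, put $$\hat p_{t,j}(c)=\sum_{s<t}\mathbb 1[c_{s,j}=c]\frac{1+Z_{s,j}y_s}{2n},\qquad \alpha_{t,j}(c)=\min\Bigl\{\frac{\beta}{n},\frac12\Bigr\},$$ $$Q_{t,j}(c)=\min\Bigl\{1-\hat p,\ \hat p,\ \frac{3\ln(3/\delta)}{n}+\sqrt{\frac{\hat p(1-\hat p)}{n}\,2\ln(3/\delta)}\Bigr\},\qquad \mathcal P_{t,j}(c)=\hat p-\mathrm{sign}(\tfrac12-\hat p)\,Q_{t,j}(c).$$ In a round $t\le N$, choose any $c_{t,j}\in\mathcal C$ with $n_{t,j}(c_{t,j})=0$ for every $j$; in a round $t>N$, choose any $(c_{t,1},\dots,c_{t,K})$ minimizing $\Phi\bigl(\mathcal P_{t,1}(c_1),\dots,\mathcal P_{t,K}(c_K)\bigr)+\lambda\sum_j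 c_j$ over $\mathcal C^K$. If some $j$ satisfies $\hat p_{t,j}(c_{t,j})\notin[\alpha_{t,j}(c_{t,j}),1-\alpha_{t,j}(c_{t,j})]$, pick any such $j$ and predict $\hat y_t=\mathrm{sign}(\hat p_{t,j}(c_{t,j})-\tfrac12)Z_{t,j}$. Otherwise let $x_t=\sum_{j}\tfrac12\ln\frac{\hat p_{t,j}(c_{t,j})}{1-\hat p_{t,j}(c_{t,j})}\,Z_{t,j}$ and, conditionally on $\mathcal F_t$ and $Z_t$, predict $\hat y_t=\mathrm{sign}(x_t)$ with probability $1-\tfrac12e^{-x_t\mathrm{sign}(x_t)}$ and $\hat y_t=-\mathrm{sign}(x_t)$ with probability $\tfrac12e^{-x_t\mathrm{sign}(x_t)}$. **Theorem.** Suppose that for every $c^\star\in[0,1]$ there is $\tilde c\in\mathcal C$ with $|\tilde c-c^\star|\le\varepsilon$. Let $\delta\in(0,1)$ and $\beta=18\ln(3/\delta)K^2$. Then the minimum $\min_{c\in[0,1]^K}\{\Phi(p(c))+\lambda\sum_jc_j\}$ exists, and the predictions and payments of LCB-GAPTRON satisfy $$\begin{aligned}\sum_{t=1}^T\mathbb E\Bigl[\mathbb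 1[\hat y_t\ne y_t]+\lambda\sum_{j=1}^Kc_{t,j}\Bigr]\ \le\ {}&T\min_{c\in[0,1]^K}\Bigl\{\Phi(p(c))+\lambda\sum_{j=1}^Kc_j\Bigr\}+(1+\lambda K)T^3K\delta+T(4L+\lambda)K\varepsilon\\&+N\Bigl(1+\lambda K+2592K^2\bigl(\ln(3/\delta)\bigr)^2+(1+\ln T)\bigl(K(2\beta+4\ln(3/\delta))+576K^2\ln(3/\delta)\bigr)\Bigr).\end{aligned}$$ (For $T=0$ read $\ln T$ as $0$.) -/

import Mathlib

open MeasureTheory ProbabilityTheory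

noncomputable section

namespace PaidExperts

/-- The sign function with values in `{-1, 1}` (with `sgn 0 = 1`). -/
def sgn (x : ℝ) : ℝ := if 0 ≤ x then 1 else -1

/-- The function `Φ(q) = exp (-2 ∑ⱼ (1/2 - qⱼ)²)`. -/
def Phi {K : ℕ} (q : Fin K → ℝ) : ℝ :=
  Real.exp (-2 * ∑ j, (1 / 2 - q j) ^ 2)

/-- The values `Φ(p(c)) + lam ∑ⱼ cⱼ`, where `c` ranges over `[0,1]^K`. -/
def objectiveValues {K : ℕ} (lam : ℝ) (p : Fin K → ℝ → ℝ) : Set ℝ :=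
  (fun c : Fin K → ℝ => Phi (fun j => p j (c j)) + lam * ∑ j, c j) ''
    {c | ∀ j, c j ∈ Set.Icc (0 : ℝ) 1}

/-- The optimal per-round cost `min_{c ∈ [0,1]^K} {Φ(p(c)) + lam ∑ⱼ cⱼ}`. -/
def opt {K : ℕ} (lam : ℝ) (p : Fin K → ℝ → ℝ) : ℝ := sInf (objectiveValues lam p)

/-! ### Statistics of the algorithm

In this section `c s` and `Z s` are the vectors of payments and of expert predictions of round `s`
(rounds are numbered from `1`) and `y s` is the true label. All statistics of round `t` depend on
the rounds `1, …, t - 1` only. -/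

section Statistics

variable {K : ℕ} (c Z : ℕ → Fin K → ℝ) (y : ℕ → ℝ)

/-- `n_{t,j}(a)`: the number of rounds before `t` in which expert `j` was paid `a`. -/
def numPaid (t : ℕ) (j : Fin K) (a : ℝ) : ℕ :=
  ((Finset.Ico 1 t).filter (fun s => c s j = a)).card

/-- `p̂_{t,j}(a)`: the fraction of correct predictions of expert `j` among the rounds before `t`
with payment `a`, and the initial value `1` if there is no such round. -/
def phat (t : ℕ) (j : Fin K) (a : ℝ) : ℝ :=
  if numPaid c t j a = 0 then 1
  else ∑ s ∈ (Finset.Ico 1 t).filter (fun s => c s j = a),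
    (1 + Z s j * y s) / (2 * (numPaid c t j a : ℝ))

/-- The cutoff `α_{t,j}(a)`, with initial value `1/2`. -/
def cutoff (β : ℝ) (t : ℕ) (j : Fin K) (a : ℝ) : ℝ :=
  if numPaid c t j a = 0 then 1 / 2
  else min (β / (numPaid c t j a : ℝ)) (1 / 2)

/-- The truncated width `Q_{t,j}(a)` of the empirical Bernstein confidence interval. -/
def width (δ : ℝ) (t : ℕ) (j : Fin K) (a : ℝ) : ℝ :=
  min (min (1 - phat c Z y t j a) (phat c Z y t j a))
    (3 * Real.log (3 / δ) / (numPaid c t j a : ℝ) +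
      Real.sqrt (phat c Z y t j a * (1 - phat c Z y t j a) / (numPaid c t j a : ℝ) *
        (2 * Real.log (3 / δ))))

/-- The optimistic estimate `P_{t,j}(a)`, with initial value `1`. -/
def optimistic (δ : ℝ) (t : ℕ) (j : Fin K) (a : ℝ) : ℝ :=
  if numPaid c t j a = 0 then 1
  else phat c Z y t j a - sgn (1 / 2 - phat c Z y t j a) * width c Z y δ t j a

/-- The objective that is minimized over payment vectors `a ∈ C^K` in round `t`. -/
def optimisticObjective (lam δ : ℝ) (t : ℕ) (a : Fin K → ℝ) : ℝ :=
  Phi (fun j => optimistic c Z y δ t j (a j)) + lam * ∑ j, a j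

/-- `p̂_{t,j}(c_{t,j}) ∈ [α_{t,j}(c_{t,j}), 1 - α_{t,j}(c_{t,j})]`. -/
def InRange (β : ℝ) (t : ℕ) (j : Fin K) : Prop :=
  phat c Z y t j (c t j) ∈
    Set.Icc (cutoff c β t j (c t j)) (1 - cutoff c β t j (c t j))

/-- The weighted vote `x_t = ∑ⱼ w_{t,j} Z_{t,j}`, `w_{t,j} = (1/2) log (p̂ / (1 - p̂))` at
`p̂ = p̂_{t,j}(c_{t,j})`. -/
def vote (t : ℕ) : ℝ :=
  ∑ j, (1 / 2 * Real.log (phat c Z y t j (c t j) / (1 - phat c Z y t j (c t j)))) * Z t j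

end Statistics

/-! ### The stochastic protocol and the algorithm -/

section Protocol

variable {Ω : Type*} {mΩ : MeasurableSpace Ω} {K : ℕ}

/-- The protocol of online classification with paid experts over the rounds `1, …, T`:
`ℱ t` is the information of the learner at the beginning of round `t` (past advice, past
predictions, internal randomization). Given `ℱ t`, the experts' predictions `Z_{t,1}, …, Z_{t,K}`
are independent, and expert `j` is correct with probability `p_j (c_{t,j})`. -/
structure IsProtocol (μ : Measure Ω) (ℱ : Filtration ℕ mΩ) (T : ℕ) (p : Fin K → ℝ → ℝ)
    (y : ℕ → ℝ) (c Z : ℕ → Ω → Fin K → ℝ) (yhat : ℕ → Ω → ℝ) : Prop where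
  payment_measurable : ∀ t ∈ Finset.Icc 1 T, Measurable[ℱ t] (c t)
  advice_measurable : ∀ t ∈ Finset.Icc 1 T, Measurable[ℱ (t + 1)] (Z t)
  prediction_measurable : ∀ t ∈ Finset.Icc 1 T, Measurable[ℱ (t + 1)] (yhat t)
  advice_binary : ∀ t ∈ Finset.Icc 1 T, ∀ ω j, Z t ω j = 1 ∨ Z t ω j = -1
  prediction_binary : ∀ t ∈ Finset.Icc 1 T, ∀ ω, yhat t ω = 1 ∨ yhat t ω = -1
  advice_law : ∀ t ∈ Finset.Icc 1 T, ∀ z : Fin K → ℝ, (∀ j, z j = 1 ∨ z j = -1) →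
    μ⟦{ω | Z t ω = z} | ℱ t⟧ =ᵐ[μ]
      fun ω => ∏ j, if z j = y t then p j (c t ω j) else 1 - p j (c t ω j)

/-- The payments `c` and the predictions `yhat` are chosen by LCB-GAPTRON with cost set `C`,
parameters `β`, `δ` and trade-off parameter `lam`. All ties (the choice of unexplored payments, of
a minimizer, and of an expert to follow) may be broken in any way. -/
structure IsLCBGaptron (μ : Measure Ω) (ℱ : Filtration ℕ mΩ) (T : ℕ) (C : Finset ℝ)
    (lam β δ : ℝ) (y : ℕ → ℝ) (c Z : ℕ → Ω → Fin K → ℝ) (yhat : ℕ → Ω → ℝ) : Prop where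
  payment_mem : ∀ t ∈ Finset.Icc 1 T, ∀ ω j, c t ω j ∈ C
  /-- In the first `|C|` rounds every expert receives a payment not yet tried with that expert. -/
  explore : ∀ t ∈ Finset.Icc 1 T, t ≤ C.card → ∀ ω j,
    numPaid (fun s => c s ω) t j (c t ω j) = 0
  /-- Afterwards the payments minimize the optimistic objective over `C^K`. -/
  exploit : ∀ t ∈ Finset.Icc 1 T, C.card < t → ∀ ω, ∀ a : Fin K → ℝ, (∀ j, a j ∈ C) →
    optimisticObjective (fun s => c s ω) (fun s => Z s ω) y lam δ t (c t ω) ≤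
      optimisticObjective (fun s => c s ω) (fun s => Z s ω) y lam δ t a
  /-- If some estimate is out of range, the (flipped) advice of one such expert is followed. -/
  follow : ∀ t ∈ Finset.Icc 1 T, ∀ ω,
    (∃ j, ¬ InRange (fun s => c s ω) (fun s => Z s ω) y β t j) →
    ∃ j, ¬ InRange (fun s => c s ω) (fun s => Z s ω) y β t j ∧
      yhat t ω =
        sgn (phat (fun s => c s ω) (fun s => Z s ω) y t j (c t ω j) - 1 / 2) * Z t ω j
  /-- Otherwise, given the past and the advice `Z t`, the prediction is `sgn x_t` with probability
  `1 - exp (-x_t sgn x_t) / 2` (and hence `-sgn x_t` with the remaining probability). -/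
  randomize : ∀ t ∈ Finset.Icc 1 T, ∀ᵐ ω ∂μ,
    (∀ j, InRange (fun s => c s ω) (fun s => Z s ω) y β t j) →
    (μ⟦{ω' | yhat t ω' = sgn (vote (fun s => c s ω') (fun s => Z s ω') y t)} |
        ℱ t ⊔ MeasurableSpace.comap (Z t) inferInstance⟧) ω =
      1 - 1 / 2 * Real.exp (-(vote (fun s => c s ω) (fun s => Z s ω) y t *
        sgn (vote (fun s => c s ω) (fun s => Z s ω) y t)))

/-- The expected cumulative cost
`∑_{t=1}^T 𝔼[𝟙[ŷ_t ≠ y_t] + lam ∑ⱼ c_{t,j}]`. -/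
def expectedCost (μ : Measure Ω) (T : ℕ) (lam : ℝ) (y : ℕ → ℝ) (c : ℕ → Ω → Fin K → ℝ)
    (yhat : ℕ → Ω → ℝ) : ℝ :=
  ∑ t ∈ Finset.Icc 1 T,
    ∫ ω, ((if yhat t ω ≠ y t then (1 : ℝ) else 0) + lam * ∑ j, c t ω j) ∂μ

end Protocol

end PaidExperts

end

namespace PaidExperts

/-- The radius of the empirical Bernstein confidence interval around the frequency `q` of `n`
observations, at confidence level `exp (-ℓ)`. -/
noncomputable def radius (ℓ : ℝ) (n : ℕ) (q : ℝ) : ℝ :=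
  3 * ℓ / (n : ℝ) + Real.sqrt (q * (1 - q) / (n : ℝ) * (2 * ℓ))

lemma radius_nonneg {ℓ : ℝ} (hℓ : 0 < ℓ) (n : ℕ) (q : ℝ) : 0 ≤ radius ℓ n q := by
  unfold radius; positivity

lemma radius_one_sub (ℓ : ℝ) (n : ℕ) (q : ℝ) : radius ℓ n (1 - q) = radius ℓ n q := by
  rw [radius, radius, show (1 - q) * (1 - (1 - q)) = q * (1 - q) by ring]

/-- A Bernstein type lower bound for the binary relative entropy, with the variance of the first
argument. -/
lemma le_binary_relative_entropy {q p : ℝ} (hq : 0 ≤ q) (hqp : q < p) (hp : p < 1) :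
    (p - q) ^ 2 / (2 * (q * (1 - q) + (p - q))) ≤
      q * Real.log (q / p) + (1 - q) * Real.log ((1 - q) / (1 - p)) := by
  rcases hq.eq_or_lt with rfl | hq0
  · have h1 : Real.log (1 - p) ≤ -p := by
      have := Real.log_le_sub_one_of_pos (show 0 < 1 - p by linarith)
      linarith
    have h2 : (p - 0) ^ 2 / (2 * (0 * (1 - 0) + (p - 0))) = p / 2 := by
      rw [zero_mul, zero_add, sub_zero, sq, mul_comm 2 p, mul_div_mul_left _ _ hqp.ne']
    rw [h2]
    simp only [zero_mul, sub_zero, one_mul, zero_add, one_div, Real.log_inv]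
    linarith
  set v := q * (1 - q) with hv
  have hv0 : 0 < v := mul_pos hq0 (by linarith)
  let F : ℝ → ℝ := fun x => -q * Real.log x - (1 - q) * Real.log (1 - x)
    - (x - q) ^ 2 / (2 * (v + (x - q)))
  have hder : ∀ x ∈ Set.Icc q p, HasDerivAt F (-q * (1 / x) - (1 - q) * (-1 / (1 - x))
      - ((2 * (x - q)) * (2 * (v + (x - q))) - (x - q) ^ 2 * 2) / (2 * (v + (x - q))) ^ 2) x := by
    intro x hx
    have hx0 : x ≠ 0 := by linarith [hx.1]
    have hx1 : 1 - x ≠ 0 := by linarith [hx.2]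
    have hd0 : 2 * (v + (x - q)) ≠ 0 := by linarith [hx.1]
    have e1 : HasDerivAt (fun x : ℝ => Real.log x) (1 / x) x :=
      (hasDerivAt_id x).log hx0
    have e2 : HasDerivAt (fun x : ℝ => Real.log (1 - x)) (-1 / (1 - x)) x :=
      ((hasDerivAt_id x).const_sub 1).log hx1
    have e3 : HasDerivAt (fun x : ℝ => (x - q) ^ 2) (2 * (x - q)) x := by
      have := ((hasDerivAt_id x).sub_const q).fun_pow 2
      simpa using this
    have e4 : HasDerivAt (fun x : ℝ => 2 * (v + (x - q))) 2 x := by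
      simpa using (((hasDerivAt_id x).sub_const q).const_add v).const_mul 2
    exact ((e1.const_mul (-q)).sub (e2.const_mul (1 - q))).sub (e3.div e4 hd0)
  have hmono : MonotoneOn F (Set.Icc q p) := by
    apply monotoneOn_of_deriv_nonneg (convex_Icc q p)
    · exact fun x hx => (hder x hx).continuousAt.continuousWithinAt
    · exact fun x hx => (hder x (interior_subset hx)).differentiableAt.differentiableWithinAt
    · intro x hx
      have hx := interior_subset hx
      rw [(hder x hx).deriv]
      have hx0 : 0 < x := by linarith [hx.1]
      have hx1 : 0 < 1 - x := by linarith [hx.2]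
      have hd : 0 ≤ x - q := by linarith [hx.1]
      have hd0 : 0 < v + (x - q) := by linarith
      have k1 : -q * (1 / x) - (1 - q) * (-1 / (1 - x)) = (x - q) / (x * (1 - x)) := by
        field_simp
        ring
      have k2 : ((2 * (x - q)) * (2 * (v + (x - q))) - (x - q) ^ 2 * 2) /
          (2 * (v + (x - q))) ^ 2 ≤ (x - q) / (v + (x - q)) := by
        rw [div_le_div_iff₀ (by positivity) hd0]
        have : 0 ≤ (x - q) ^ 2 * (v + (x - q)) := by positivity
        nlinarith
      have k3 : (x - q) / (v + (x - q)) ≤ (x - q) / (x * (1 - x)) := by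
        apply div_le_div_of_nonneg_left hd (mul_pos hx0 hx1)
        rw [hv]
        nlinarith
      rw [k1]
      linarith
  have h := hmono (Set.left_mem_Icc.2 hqp.le) (Set.right_mem_Icc.2 hqp.le) hqp.le
  simp only [F, sub_self] at h
  rw [Real.log_div hq0.ne' (by linarith), Real.log_div (by linarith) (by linarith)]
  simp only [ne_eq, OfNat.ofNat_ne_zero, not_false_eq_true, zero_pow, zero_div] at h
  linarith

lemma le_mul_sq_div_of_radius_lt {ℓ v d : ℝ} {n : ℕ} (hℓ : 0 < ℓ) (hn : 0 < n) (hv : 0 ≤ v)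
    (hd : 3 * ℓ / (n : ℝ) + Real.sqrt (v / (n : ℝ) * (2 * ℓ)) ≤ d) :
    ℓ ≤ n * (d ^ 2 / (2 * (v + d))) := by
  have hn' : (0 : ℝ) < n := by exact_mod_cast hn
  set x := ℓ / n with hx
  have hx0 : 0 < x := by positivity
  have hℓx : ℓ = n * x := by rw [hx]; field_simp
  set r := Real.sqrt (v / (n : ℝ) * (2 * ℓ)) with hr
  have hr0 : 0 ≤ r := Real.sqrt_nonneg _
  have hr2 : r ^ 2 = 2 * v * x := by
    rw [hr, Real.sq_sqrt (by positivity), hx]; ring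
  have hd' : 3 * x + r ≤ d := by
    have : 3 * ℓ / (n : ℝ) = 3 * x := by rw [hx]; ring
    rwa [this] at hd
  have hd0 : 0 < d := by linarith
  have key : x ≤ d ^ 2 / (2 * (v + d)) := by
    rw [le_div_iff₀ (by positivity)]
    nlinarith [mul_nonneg hr0 hx0.le, mul_nonneg (sub_nonneg.2 hd') hr0,
      mul_nonneg (sub_nonneg.2 hd') hx0.le, sq_nonneg (d - (3 * x + r))]
  calc ℓ = n * x := hℓx
    _ ≤ _ := by gcongr

lemma exists_bet_of_lt {ℓ p : ℝ} {n k : ℕ} (hℓ : 0 < ℓ) (hp1 : p ≤ 1) (hn : 0 < n)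
    (hk : (k : ℝ) / n + radius ℓ n (k / n) < p) :
    ∃ A B : ℝ, 0 ≤ A ∧ A ≤ B ∧ p * A + (1 - p) * B ≤ 1 ∧ Real.exp ℓ ≤ A ^ k * B ^ (n - k) := by
  have hn' : (0 : ℝ) < n := by exact_mod_cast hn
  set q : ℝ := (k : ℝ) / n with hq
  have hq0 : 0 ≤ q := by positivity
  have hr := radius_nonneg hℓ n q
  have hqp : q < p := by linarith
  have hkn : k < n := by
    have : q < 1 := by linarith
    rw [hq, div_lt_one hn'] at this
    exact_mod_cast this
  rcases hp1.eq_or_lt with rfl | hp1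
  · have h1 : 1 ≤ Real.exp ℓ := Real.one_le_exp hℓ.le
    refine ⟨1, Real.exp ℓ, zero_le_one, h1, by simp, ?_⟩
    rw [one_pow, one_mul]
    exact le_self_pow₀ h1 (by omega)
  have hp0 : 0 < p := by linarith
  have hB0 : 0 < (1 - q) / (1 - p) := div_pos (by linarith) (by linarith)
  refine ⟨q / p, (1 - q) / (1 - p), by positivity, ?_, ?_, ?_⟩
  · calc q / p ≤ 1 := (div_le_one hp0).2 hqp.le
      _ ≤ _ := (one_le_div (by linarith)).2 (by linarith)
  · rw [mul_div_cancel₀ _ hp0.ne', mul_div_cancel₀ _ (by linarith)]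
    linarith
  · have hkq : (k : ℝ) = n * q := by rw [hq]; field_simp
    have hA : (q / p) ^ k = Real.exp (n * (q * Real.log (q / p))) := by
      rcases Nat.eq_zero_or_pos k with h0 | h0
      · have : q = 0 := by rw [hq, h0]; simp
        rw [this, h0]; simp
      · have hqpos : 0 < q := by
          rw [hq]; positivity
        rw [← mul_assoc, ← hkq, Real.exp_nat_mul, Real.exp_log (by positivity)]
    have hB : ((1 - q) / (1 - p)) ^ (n - k) =
        Real.exp (n * ((1 - q) * Real.log ((1 - q) / (1 - p)))) := by
      have : (n : ℝ) * (1 - q) = ((n - k : ℕ) : ℝ) := by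
        rw [Nat.cast_sub hkn.le, hkq]; ring
      rw [← mul_assoc, this, Real.exp_nat_mul, Real.exp_log hB0]
    rw [hA, hB, ← Real.exp_add, ← mul_add]
    apply Real.exp_le_exp.2
    calc ℓ ≤ n * ((p - q) ^ 2 / (2 * (q * (1 - q) + (p - q)))) := by
          apply le_mul_sq_div_of_radius_lt hℓ hn (mul_nonneg hq0 (by linarith))
          unfold radius at hk
          linarith
      _ ≤ _ := by
          gcongr
          exact le_binary_relative_entropy hq0 hqp hp1

/-- A betting strategy against success probability `p` whose final wealth is at least `exp ℓ`
whenever the frequency of successes in `n` trials is too small. -/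
lemma exists_bet {ℓ p : ℝ} {n : ℕ} (hℓ : 0 < ℓ) (hp1 : p ≤ 1) (hn : 0 < n) :
    ∃ A B : ℝ, 0 ≤ A ∧ 0 ≤ B ∧ p * A + (1 - p) * B ≤ 1 ∧ ∀ k ≤ n,
      (k : ℝ) / n + radius ℓ n (k / n) < p → Real.exp ℓ ≤ A ^ k * B ^ (n - k) := by
  classical
  set S := (Finset.range (n + 1)).filter
    (fun k : ℕ => (k : ℝ) / n + radius ℓ n (k / n) < p) with hS
  rcases S.eq_empty_or_nonempty with h | h
  · refine ⟨1, 1, zero_le_one, zero_le_one, by simp, fun k hk hb => ?_⟩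
    have : k ∈ S := by rw [hS, Finset.mem_filter, Finset.mem_range]; exact ⟨by omega, hb⟩
    simp [h] at this
  · have hm := S.max'_mem h
    obtain ⟨A, B, hA, hAB, h1, h2⟩ := exists_bet_of_lt hℓ hp1 hn (Finset.mem_filter.1 hm).2
    refine ⟨A, B, hA, hA.trans hAB, h1, fun k hk hb => h2.trans ?_⟩
    have hkm : k ≤ S.max' h := by
      apply Finset.le_max'
      rw [hS, Finset.mem_filter, Finset.mem_range]; exact ⟨by omega, hb⟩
    obtain ⟨i, hi⟩ := Nat.exists_eq_add_of_le hkm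
    have hmn : S.max' h < n + 1 := Finset.mem_range.1 (Finset.mem_filter.1 hm).1
    have hni : n - k = i + (n - S.max' h) := by omega
    rw [hni, pow_add, ← mul_assoc]
    nth_rewrite 1 [hi]
    rw [pow_add]
    have := hA.trans hAB
    gcongr

/-- The version of `exists_bet` for too large frequencies. -/
lemma exists_bet' {ℓ p : ℝ} {n : ℕ} (hℓ : 0 < ℓ) (hp0 : 0 ≤ p) (hn : 0 < n) :
    ∃ A B : ℝ, 0 ≤ A ∧ 0 ≤ B ∧ p * A + (1 - p) * B ≤ 1 ∧ ∀ k ≤ n,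
      p < (k : ℝ) / n - radius ℓ n (k / n) → Real.exp ℓ ≤ A ^ k * B ^ (n - k) := by
  obtain ⟨A, B, hA, hB, h1, h2⟩ := exists_bet (p := 1 - p) hℓ (by linarith) hn
  refine ⟨B, A, hB, hA, by linarith, fun k hk hb => ?_⟩
  have hn' : (n : ℝ) ≠ 0 := by exact_mod_cast hn.ne'
  have := h2 (n - k) (by omega) (by
    rw [Nat.cast_sub hk, sub_div, div_self hn', radius_one_sub]
    linarith)
  rwa [Nat.sub_sub_self hk, mul_comm] at this

lemma sgn_mul_self (x : ℝ) : sgn x * sgn x = 1 := by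
  unfold sgn; split_ifs <;> norm_num

lemma sgn_eq_or (x : ℝ) : sgn x = 1 ∨ sgn x = -1 := by
  unfold sgn; split_ifs <;> simp

lemma mul_sgn (x : ℝ) : x * sgn x = |x| := by
  unfold sgn
  split_ifs with h
  · rw [abs_of_nonneg h, mul_one]
  · rw [abs_of_neg (not_le.1 h)]; ring

/-- Moving `q` away from `1/2` by `Q`. -/
lemma half_sub_optimistic_sq (q Q : ℝ) :
    (1 / 2 - (q - sgn (1 / 2 - q) * Q)) ^ 2 = (|1 / 2 - q| + Q) ^ 2 := by
  rw [← mul_sgn]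
  linear_combination (Q ^ 2 - (1 / 2 - q) ^ 2) * sgn_mul_self (1 / 2 - q)

lemma optimism {q p s : ℝ} (hq : q ∈ Set.Icc (0 : ℝ) 1) (hp : p ∈ Set.Icc (0 : ℝ) 1)
    (h : |q - p| ≤ s) :
    (1 / 2 - p) ^ 2 ≤ (1 / 2 - (q - sgn (1 / 2 - q) * min (min (1 - q) q) s)) ^ 2 := by
  obtain ⟨hq0, hq1⟩ := hq
  obtain ⟨hp0, hp1⟩ := hp
  rw [half_sub_optimistic_sq]
  have hs : 0 ≤ s := (abs_nonneg _).trans h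
  have hQ : 0 ≤ min (min (1 - q) q) s := le_min (le_min (by linarith) hq0) hs
  apply sq_le_sq'
  all_goals
    have h1 := abs_le.1 h
    rcases min_cases (min (1 - q) q) s with h2 | h2 <;>
    rcases min_cases (1 - q) q with h3 | h3 <;>
    rcases abs_cases (1 / 2 - q) with h4 | h4 <;>
    linarith

lemma le_of_lt_div {ℓ β q p : ℝ} {n : ℕ} (hℓ : 0 < ℓ) (hβ : 0 ≤ β) (hn : 0 < n) (hq0 : 0 ≤ q)
    (hq : q < β / n) (h : p ≤ q + radius ℓ n q) : p ≤ (2 * β + 4 * ℓ) / n := by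
  have hn' : (0 : ℝ) < n := by exact_mod_cast hn
  have h1 : Real.sqrt (q * (1 - q) / (n : ℝ) * (2 * ℓ)) ≤ ℓ / n + q / 2 := by
    apply Real.sqrt_le_iff.2
    refine ⟨by positivity, ?_⟩
    have : q * (1 - q) / (n : ℝ) * (2 * ℓ) = 2 * (q * (1 - q)) * (ℓ / n) := by ring
    rw [this]
    have hx : 0 < ℓ / n := by positivity
    nlinarith [sq_nonneg (ℓ / n - q / 2), mul_nonneg (sq_nonneg q) hx.le]
  unfold radius at h
  have h2 : (2 * β + 4 * ℓ) / n = 2 * (β / n) + 3 * ℓ / n + ℓ / n := by ring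
  rw [h2]
  have h3 : 0 ≤ β / n := by positivity
  linarith

lemma radius_le_mul_variance {ℓ q κ : ℝ} {n : ℕ} (hℓ : 0 < ℓ) (hκ : 1 ≤ κ) (hn : 0 < n)
    (hq : q ∈ Set.Icc (18 * ℓ * κ ^ 2 / n) (1 - 18 * ℓ * κ ^ 2 / n)) :
    radius ℓ n q ≤ 2 * (q * (1 - q)) * (403 / 1000 / κ) := by
  have hn' : (0 : ℝ) < n := by exact_mod_cast hn
  set x := ℓ / n with hx
  have hx0 : 0 < x := by positivity
  have hb : 18 * ℓ * κ ^ 2 / n = 18 * κ ^ 2 * x := by rw [hx]; ring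
  rw [hb] at hq
  obtain ⟨h1, h2⟩ := hq
  set v := q * (1 - q) with hv
  have hκx : 0 < κ ^ 2 * x := by positivity
  have hvx : 9 * (κ ^ 2 * x) ≤ v := by
    rw [hv]
    nlinarith
  have hv0 : 0 < v := by linarith
  have hκ0 : 0 < κ := by linarith
  have hw : 3 * ℓ / n = 3 * x := by rw [hx]; ring
  have hs : Real.sqrt (v / n * (2 * ℓ)) ≤ 472 / 1000 * (v / κ) := by
    apply Real.sqrt_le_iff.2
    refine ⟨by positivity, ?_⟩
    have e1 : v / n * (2 * ℓ) = 2 * (κ ^ 2 * x) * v / κ ^ 2 := by rw [hx]; field_simp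
    have e2 : (472 / 1000 * (v / κ)) ^ 2 = (472 / 1000) ^ 2 * v ^ 2 / κ ^ 2 := by
      field_simp
    rw [e1, e2]
    apply div_le_div_of_nonneg_right _ (by positivity)
    nlinarith
  have hx3 : 3 * x ≤ 1 / 3 * (v / κ) := by
    have : x ≤ v / κ / 9 := by
      rw [div_div, le_div_iff₀ (by positivity)]
      nlinarith [mul_pos hx0 hκ0]
    linarith
  unfold radius
  rw [hw, ← hv]
  have e : 2 * v * (403 / 1000 / κ) = 806 / 1000 * (v / κ) := by ring
  rw [e]
  have : 0 < v / κ := by positivity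
  linarith

lemma exp_half_log {x : ℝ} (hx : 0 < x) : Real.exp (1 / 2 * Real.log x) = Real.sqrt x := by
  rw [Real.sqrt_eq_rpow, Real.rpow_def_of_pos hx, mul_comm]

lemma vote_exponent_le {s v D Q κ : ℝ} (hκ : 1 ≤ κ) (hv0 : 0 < v) (hD0 : 0 ≤ D)
    (hD2 : D ^ 2 = 1 - 4 * v) (hQ0 : 0 ≤ Q) (hQ : Q ≤ s)
    (hrad : s ≤ 2 * v * (403 / 1000 / κ)) :
    s * D / (2 * v) + 2 * D * Q + 2 * Q ^ 2 ≤ 3 / 5 / κ := by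
  have hκ0 : 0 < κ := by linarith
  have hs0 : 0 ≤ s := hQ0.trans hQ
  have hh : s / (2 * v) ≤ 403 / 1000 / κ := by
    rw [div_le_iff₀ (by positivity)]; linarith
  have hκ1 : 1 / κ ≤ 1 := (div_le_one hκ0).2 hκ
  have f1 : s * D / (2 * v) + 2 * D * s = s / (2 * v) * (D * (2 - D ^ 2)) := by
    rw [hD2]; field_simp; ring
  have hD1 : D ≤ 1 := by nlinarith
  have f2 : D * (2 - D ^ 2) ≤ 11 / 10 := by
    nlinarith [mul_nonneg hD0 (sq_nonneg (D - 4 / 5)), sq_nonneg (D - 4 / 5)]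
  have f3 : s / (2 * v) * (D * (2 - D ^ 2)) ≤ 403 / 1000 / κ * (11 / 10) := by
    apply mul_le_mul hh f2 (mul_nonneg hD0 (by nlinarith)) (by positivity)
  have f4 : s ≤ 1 / 2 * (403 / 1000 / κ) := by
    have : 4 * v ≤ 1 := by nlinarith [sq_nonneg D]
    calc s ≤ 2 * v * (403 / 1000 / κ) := hrad
      _ ≤ 1 / 2 * (403 / 1000 / κ) := by gcongr; linarith
  have f5 : Q ^ 2 ≤ (1 / 2 * (403 / 1000 / κ)) ^ 2 := by
    gcongr; linarith
  have f6 : 2 * D * Q ≤ 2 * D * s := by gcongr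
  set u := 1 / κ with hu
  have hu0 : 0 < u := by positivity
  have g1 : 403 / 1000 / κ = 403 / 1000 * u := by rw [hu]; ring
  have g2 : 3 / 5 / κ = 3 / 5 * u := by rw [hu]; ring
  rw [g1] at f3 f5
  rw [g2]
  have hu2 : u ^ 2 ≤ u := by nlinarith
  linarith [show (1 / 2 * (403 / 1000 * u)) ^ 2 = (403 / 2000) ^ 2 * u ^ 2 by ring]

/-- One factor of the exponential moment of the vote, for an estimate `q` in range. -/
lemma vote_factor_le {ℓ q p κ Q : ℝ} {n : ℕ} (hℓ : 0 < ℓ) (hκ : 1 ≤ κ) (hn : 0 < n)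
    (hq : q ∈ Set.Icc (18 * ℓ * κ ^ 2 / n) (1 - 18 * ℓ * κ ^ 2 / n))
    (h : |q - p| ≤ radius ℓ n q) (hQ0 : 0 ≤ Q) (hQ : Q ≤ radius ℓ n q) :
    p * Real.exp (-(1 / 2 * Real.log (q / (1 - q)))) +
      (1 - p) * Real.exp (1 / 2 * Real.log (q / (1 - q))) ≤
    Real.exp (3 / 5 / κ - 2 * (1 / 2 - (q - sgn (1 / 2 - q) * Q)) ^ 2) := by
  have hn' : (0 : ℝ) < n := by exact_mod_cast hn
  have hκ0 : 0 < κ := by linarith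
  have hb : 0 < 18 * ℓ * κ ^ 2 / n := by positivity
  have hrad := radius_le_mul_variance hℓ hκ hn hq
  set s := radius ℓ n q
  obtain ⟨hq0, hq1⟩ : 0 < q ∧ 0 < 1 - q := ⟨by linarith [hq.1], by linarith [hq.2]⟩
  set v := q * (1 - q) with hv
  have hv0 : 0 < v := mul_pos hq0 hq1
  have hs0 : 0 ≤ s := hQ0.trans hQ
  set D := |1 - 2 * q| with hD
  have hD0 : 0 ≤ D := abs_nonneg _
  have hD2 : D ^ 2 = 1 - 4 * v := by rw [hD, sq_abs, hv]; ring
  have hhalf : |1 / 2 - q| = D / 2 := by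
    rw [hD, show (1 : ℝ) / 2 - q = (1 - 2 * q) / 2 by ring, abs_div]; norm_num
  rw [half_sub_optimistic_sq, hhalf, ← mul_neg, ← Real.log_inv, exp_half_log (by positivity),
    exp_half_log (by positivity), inv_div]
  have e1 : Real.sqrt (q / (1 - q)) = q / Real.sqrt v := by
    rw [eq_div_iff (by positivity), hv, ← Real.sqrt_mul (by positivity),
      show q / (1 - q) * (q * (1 - q)) = q ^ 2 by field_simp, Real.sqrt_sq hq0.le]
  have e2 : Real.sqrt ((1 - q) / q) = (1 - q) / Real.sqrt v := by
    rw [eq_div_iff (by positivity), hv, ← Real.sqrt_mul (by positivity),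
      show (1 - q) / q * (q * (1 - q)) = (1 - q) ^ 2 by field_simp, Real.sqrt_sq hq1.le]
  have hb0 : 0 < Real.sqrt v := Real.sqrt_pos.2 hv0
  have hbb : Real.sqrt v ^ 2 = v := Real.sq_sqrt hv0.le
  have e3 : p * ((1 - q) / Real.sqrt v) + (1 - p) * (q / Real.sqrt v) =
      (2 * Real.sqrt v) * (1 + (p - q) * (1 - 2 * q) / (2 * v)) := by
    have g1 : (1 : ℝ) / Real.sqrt v = Real.sqrt v / v := Real.sqrt_div_self'.symm
    have g2 : v * (Real.sqrt v / v) = Real.sqrt v := mul_div_cancel₀ _ hv0.ne'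
    calc p * ((1 - q) / Real.sqrt v) + (1 - p) * (q / Real.sqrt v)
        = (p * (1 - q) + (1 - p) * q) * (1 / Real.sqrt v) := by ring
      _ = 2 * (v * (Real.sqrt v / v)) + (p - q) * (1 - 2 * q) * (Real.sqrt v / v) := by
        rw [g1, show p * (1 - q) + (1 - p) * q = 2 * v + (p - q) * (1 - 2 * q) by rw [hv]; ring]
        ring
      _ = _ := by rw [g2]; field_simp
  have e4 : (p - q) * (1 - 2 * q) / (2 * v) ≤ s * D / (2 * v) := by
    apply div_le_div_of_nonneg_right _ (by positivity)
    calc (p - q) * (1 - 2 * q) ≤ |(p - q) * (1 - 2 * q)| := le_abs_self _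
      _ = |q - p| * D := by rw [abs_mul, abs_sub_comm]
      _ ≤ s * D := by gcongr
  have e5 : 2 * Real.sqrt v ≤ Real.exp (-(D ^ 2 / 2)) := by
    apply le_of_sq_le_sq _ (Real.exp_pos _).le
    rw [← Real.exp_nat_mul, mul_pow, hbb]
    have := Real.add_one_le_exp (-(D ^ 2))
    have e : ((2 : ℕ) : ℝ) * (-(D ^ 2 / 2)) = -(D ^ 2) := by push_cast; ring
    rw [e]
    linarith
  have e6 := vote_exponent_le hκ hv0 hD0 hD2 hQ0 hQ hrad
  rw [e1, e2, e3]
  calc 2 * Real.sqrt v * (1 + (p - q) * (1 - 2 * q) / (2 * v))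
      ≤ 2 * Real.sqrt v * Real.exp (s * D / (2 * v)) := by
        gcongr
        linarith [Real.add_one_le_exp (s * D / (2 * v))]
    _ ≤ Real.exp (-(D ^ 2 / 2)) * Real.exp (s * D / (2 * v)) := by gcongr
    _ = Real.exp (-(D ^ 2 / 2) + s * D / (2 * v)) := (Real.exp_add _ _).symm
    _ ≤ _ := by
        apply Real.exp_le_exp.2
        linarith [show 2 * (D / 2 + Q) ^ 2 = D ^ 2 / 2 + (2 * D * Q + 2 * Q ^ 2) by ring]

section Objective

variable {K : ℕ}

lemma Phi_nonneg (q : Fin K → ℝ) : 0 ≤ Phi q := (Real.exp_pos _).le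

lemma Phi_le_of_sq_le {q r : Fin K → ℝ} (h : ∀ j, (1 / 2 - r j) ^ 2 ≤ (1 / 2 - q j) ^ 2) :
    Phi q ≤ Phi r := by
  unfold Phi
  apply Real.exp_le_exp.2
  have := Finset.sum_le_sum (fun j (_ : j ∈ Finset.univ) => h j)
  linarith

lemma Phi_le_add {q r : Fin K → ℝ} (hq : ∀ j, q j ∈ Set.Icc (0 : ℝ) 1)
    (hr : ∀ j, r j ∈ Set.Icc (0 : ℝ) 1) : Phi q ≤ Phi r + 2 * ∑ j, |q j - r j| := by
  have hS : ∑ j, (1 / 2 - r j) ^ 2 - ∑ j, (1 / 2 - q j) ^ 2 ≤ ∑ j, |q j - r j| := by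
    rw [← Finset.sum_sub_distrib]
    apply Finset.sum_le_sum
    intro j _
    have h1 : |1 - q j - r j| ≤ 1 :=
      abs_le.2 ⟨by linarith [(hq j).2, (hr j).2], by linarith [(hq j).1, (hr j).1]⟩
    calc (1 / 2 - r j) ^ 2 - (1 / 2 - q j) ^ 2 = (q j - r j) * (1 - q j - r j) := by ring
      _ ≤ |q j - r j| * |1 - q j - r j| := by rw [← abs_mul]; exact le_abs_self _
      _ ≤ |q j - r j| := mul_le_of_le_one_right (abs_nonneg _) h1
  have hA : Phi q ≤ 1 := by
    unfold Phi
    apply Real.exp_le_one_iff.2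
    have : 0 ≤ ∑ j, (1 / 2 - q j) ^ 2 := Finset.sum_nonneg fun j _ => sq_nonneg _
    linarith
  have h0 : 0 ≤ ∑ j, |q j - r j| := Finset.sum_nonneg fun j _ => abs_nonneg _
  have hB : Phi r = Phi q *
      Real.exp (-(2 * (∑ j, (1 / 2 - r j) ^ 2 - ∑ j, (1 / 2 - q j) ^ 2))) := by
    unfold Phi
    rw [← Real.exp_add]
    congr 1
    ring
  have hC := Real.add_one_le_exp (-(2 * (∑ j, (1 / 2 - r j) ^ 2 - ∑ j, (1 / 2 - q j) ^ 2)))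
  have hD := mul_le_mul_of_nonneg_left hC (Phi_nonneg q)
  rw [← hB] at hD
  have hE : Phi q * (∑ j, (1 / 2 - r j) ^ 2 - ∑ j, (1 / 2 - q j) ^ 2) ≤ ∑ j, |q j - r j| :=
    (mul_le_mul_of_nonneg_left hS (Phi_nonneg q)).trans (mul_le_of_le_one_left h0 hA)
  linarith

lemma isLeast_opt {lam L : ℝ} {p : Fin K → ℝ → ℝ}
    (hpL : ∀ j, ∀ a ∈ Set.Icc (0 : ℝ) 1, ∀ b ∈ Set.Icc (0 : ℝ) 1,
      |p j a - p j b| ≤ L * |a - b|) :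
    IsLeast (objectiveValues lam p) (opt lam p) := by
  have hcont : ∀ j, ContinuousOn (p j) (Set.Icc 0 1) := fun j => by
    apply LipschitzOnWith.continuousOn (K := Real.toNNReal L)
    apply LipschitzOnWith.of_dist_le_mul
    intro a ha b hb
    rw [Real.dist_eq, Real.dist_eq]
    exact (hpL j a ha b hb).trans
      (mul_le_mul_of_nonneg_right (Real.le_coe_toNNReal L) (abs_nonneg _))
  have hset : {c : Fin K → ℝ | ∀ j, c j ∈ Set.Icc (0 : ℝ) 1} =
      Set.pi Set.univ fun _ => Set.Icc 0 1 := by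
    ext c
    simp only [Set.mem_ofPred_eq, Set.mem_pi, Set.mem_univ, true_imp_iff]
  have hcomp : IsCompact (objectiveValues lam p) := by
    unfold objectiveValues
    rw [hset]
    apply (isCompact_univ_pi fun _ => isCompact_Icc).image_of_continuousOn
    have h1 : ∀ j, ContinuousOn (fun c : Fin K → ℝ => p j (c j))
        (Set.pi Set.univ fun _ => Set.Icc 0 1) := fun j =>
      (hcont j).comp (continuous_apply j).continuousOn fun c hc => hc j (Set.mem_univ j)
    unfold Phi
    refine ContinuousOn.add (ContinuousOn.rexp (continuousOn_const.mul
      (continuousOn_finsetSum _ fun j _ => (continuousOn_const.sub (h1 j)).pow 2))) ?_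
    fun_prop
  have hne : (objectiveValues lam p).Nonempty :=
    ⟨_, Set.mem_image_of_mem _ (show (fun _ => (0 : ℝ)) ∈ _ from fun j => by simp)⟩
  exact hcomp.isLeast_sInf hne

lemma exists_grid_le {lam L ε : ℝ} (hlam : 0 < lam) {p : Fin K → ℝ → ℝ} {C : Finset ℝ}
    (hp : ∀ j, ∀ a ∈ Set.Icc (0 : ℝ) 1, p j a ∈ Set.Icc (0 : ℝ) 1)
    (hpL : ∀ j, ∀ a ∈ Set.Icc (0 : ℝ) 1, ∀ b ∈ Set.Icc (0 : ℝ) 1,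
      |p j a - p j b| ≤ L * |a - b|)
    (hC : ∀ a ∈ C, a ∈ Set.Icc (0 : ℝ) 1)
    (hCε : ∀ a ∈ Set.Icc (0 : ℝ) 1, ∃ b ∈ C, |b - a| ≤ ε) :
    ∃ a : Fin K → ℝ, (∀ j, a j ∈ C) ∧ Phi (fun j => p j (a j)) + lam * ∑ j, a j ≤
      opt lam p + (4 * L + lam) * K * ε := by
  obtain ⟨c, hc, h⟩ := (isLeast_opt (lam := lam) hpL).1
  choose a ha using fun j => hCε (c j) (hc j)
  refine ⟨a, fun j => (ha j).1, ?_⟩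
  have hL : ∀ j : Fin K, 0 ≤ L := fun j => by
    have := hpL j 0 (by simp) 1 (by simp)
    norm_num at this
    exact (abs_nonneg _).trans this
  have hε : 0 ≤ ε := by
    obtain ⟨b, -, hb⟩ := hCε 0 (by simp)
    exact (abs_nonneg _).trans hb
  have h1 := Phi_le_add (fun j => hp j _ (hC _ (ha j).1)) (fun j => hp j _ (hc j))
  have h2 : ∑ j, |p j (a j) - p j (c j)| ≤ ∑ _j : Fin K, L * ε :=
    Finset.sum_le_sum fun j _ => (hpL j _ (hC _ (ha j).1) _ (hc j)).trans
      (mul_le_mul_of_nonneg_left (ha j).2 (hL j))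
  have h3 : ∑ j, a j ≤ ∑ j, (c j + ε) :=
    Finset.sum_le_sum fun j _ => by linarith [(abs_le.1 (ha j).2).2]
  have h4 : 0 ≤ (K : ℝ) * (L * ε) := by
    rcases Nat.eq_zero_or_pos K with h0 | h0
    · simp [h0]
    · have := hL ⟨0, h0⟩
      positivity
  rw [Finset.sum_add_distrib] at h3
  simp only [Finset.sum_const, Finset.card_univ, Fintype.card_fin, nsmul_eq_mul] at h2 h3
  have h5 := mul_le_mul_of_nonneg_left h3 hlam.le
  simp only at h
  rw [← h]
  nlinarith

end Objective

section Counting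

variable {K : ℕ} (c Z : ℕ → Fin K → ℝ) (y : ℕ → ℝ)

lemma numPaid_succ {t : ℕ} (ht : 1 ≤ t) (j : Fin K) (a : ℝ) :
    numPaid c (t + 1) j a = numPaid c t j a + if c t j = a then 1 else 0 := by
  rw [numPaid, numPaid, Finset.card_filter, Finset.card_filter, Finset.sum_Ico_succ_top ht]

lemma numPaid_le (t : ℕ) (j : Fin K) (a : ℝ) : numPaid c t j a ≤ t - 1 := by
  unfold numPaid
  exact (Finset.card_filter_le _ _).trans (by simp)

lemma sum_inv_numPaid_eq (T : ℕ) (j : Fin K) (a : ℝ) :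
    ∑ t ∈ (Finset.Icc 1 T).filter (fun t => c t j = a), ((numPaid c t j a : ℝ))⁻¹ =
      ∑ i ∈ Finset.range (numPaid c (T + 1) j a), ((i : ℝ))⁻¹ := by
  induction T with
  | zero => simp [numPaid]
  | succ T ih =>
    rw [numPaid_succ c (by omega), ← Finset.insert_Icc_right_eq_Icc_add_one (by omega),
      Finset.filter_insert]
    split_ifs with h
    · rw [Finset.sum_insert (by simp), ih, Finset.sum_range_succ, add_comm]
    · rw [ih, add_zero]

lemma sum_range_inv_le {m T : ℕ} (h : m ≤ T) :
    ∑ i ∈ Finset.range m, ((i : ℝ))⁻¹ ≤ 1 + Real.log T := by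
  rcases Nat.eq_zero_or_pos m with rfl | hm
  · simpa using add_nonneg zero_le_one (Real.log_natCast_nonneg T)
  obtain ⟨m, rfl⟩ := Nat.exists_eq_add_of_le' hm
  rw [Finset.sum_range_succ']
  have h1 := harmonic_le_one_add_log m
  have h2 : Real.log m ≤ Real.log T := by
    rcases Nat.eq_zero_or_pos m with rfl | hm'
    · simpa using Real.log_natCast_nonneg T
    · exact Real.log_le_log (by exact_mod_cast hm') (by exact_mod_cast (by omega : m ≤ T))
  rw [harmonic] at h1
  push_cast at h1 ⊢
  simp only [inv_zero, add_zero]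
  linarith

/-- The total of the reciprocal counts of the chosen payments is logarithmic. -/
lemma sum_inv_numPaid_le {T : ℕ} {C : Finset ℝ} (j : Fin K)
    (hc : ∀ t ∈ Finset.Icc 1 T, c t j ∈ C) :
    ∑ t ∈ Finset.Icc 1 T, ((numPaid c t j (c t j) : ℝ))⁻¹ ≤ C.card * (1 + Real.log T) := by
  rw [← Finset.sum_fiberwise_of_maps_to hc, ← nsmul_eq_mul]
  apply Finset.sum_le_card_nsmul
  intro a _
  have : ∑ t ∈ (Finset.Icc 1 T).filter (fun t => c t j = a), ((numPaid c t j (c t j) : ℝ))⁻¹ =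
      ∑ t ∈ (Finset.Icc 1 T).filter (fun t => c t j = a), ((numPaid c t j a : ℝ))⁻¹ :=
    Finset.sum_congr rfl fun t ht => by rw [(Finset.mem_filter.1 ht).2]
  rw [this, sum_inv_numPaid_eq]
  exact sum_range_inv_le (numPaid_le c (T + 1) j a)

/-- After the exploration phase every payment has been tried. -/
lemma numPaid_pos_of_explore {C : Finset ℝ} {t : ℕ} (ht : C.card < t) (j : Fin K)
    (hc : ∀ s ∈ Finset.Icc 1 C.card, c s j ∈ C)
    (hex : ∀ s ∈ Finset.Icc 1 C.card, numPaid c s j (c s j) = 0) {a : ℝ} (ha : a ∈ C) :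
    0 < numPaid c t j a := by
  have hlt : ∀ s ∈ Finset.Icc 1 C.card, ∀ r ∈ Finset.Icc 1 C.card, s < r → c s j ≠ c r j := by
    intro s hs r hr hsr h
    have h0 := hex r hr
    rw [numPaid, Finset.card_eq_zero] at h0
    have : s ∈ (Finset.Ico 1 r).filter (fun s => c s j = c r j) :=
      Finset.mem_filter.2 ⟨Finset.mem_Ico.2 ⟨(Finset.mem_Icc.1 hs).1, hsr⟩, h⟩
    simp [h0] at this
  have hinj : Set.InjOn (fun s => c s j) (Finset.Icc 1 C.card : Finset ℕ) := by
    intro s hs r hr h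
    rcases lt_trichotomy s r with h1 | h1 | h1
    · exact absurd h (hlt s hs r hr h1)
    · exact h1
    · exact absurd h.symm (hlt r hr s hs h1)
  have himg : (Finset.Icc 1 C.card).image (fun s => c s j) = C := by
    apply Finset.eq_of_subset_of_card_le
    · intro x hx
      obtain ⟨s, hs, rfl⟩ := Finset.mem_image.1 hx
      exact hc s hs
    · rw [Finset.card_image_of_injOn hinj]; simp
  rw [← himg] at ha
  obtain ⟨s, hs, rfl⟩ := Finset.mem_image.1 ha
  rw [numPaid]
  apply Finset.card_pos.2
  have := Finset.mem_Icc.1 hs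
  exact ⟨s, Finset.mem_filter.2 ⟨Finset.mem_Ico.2 ⟨this.1, by omega⟩, rfl⟩⟩

/-- The number of rounds before `t` in which expert `j` was paid `a` and was correct. -/
noncomputable def numCorrect (t : ℕ) (j : Fin K) (a : ℝ) : ℕ :=
  ((Finset.Ico 1 t).filter (fun s => c s j = a ∧ Z s j = y s)).card

lemma numCorrect_le (t : ℕ) (j : Fin K) (a : ℝ) :
    numCorrect c Z y t j a ≤ numPaid c t j a :=
  Finset.card_le_card (Finset.monotone_filter_right _ fun _ _ h => h.1)

variable {Z y}

lemma phat_eq {t : ℕ} (hZ : ∀ s ∈ Finset.Ico 1 t, ∀ j, Z s j = 1 ∨ Z s j = -1)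
    (hy : ∀ s, y s = 1 ∨ y s = -1) {j : Fin K} {a : ℝ} (h : numPaid c t j a ≠ 0) :
    phat c Z y t j a = numCorrect c Z y t j a / numPaid c t j a := by
  have hn : (numPaid c t j a : ℝ) ≠ 0 := by exact_mod_cast h
  rw [phat, if_neg h, numCorrect, ← Finset.filter_filter, Finset.card_filter, Nat.cast_sum,
    Finset.sum_div]
  apply Finset.sum_congr rfl
  intro s hs
  have hs := (Finset.mem_filter.1 hs).1
  rcases hZ s hs j with h1 | h1 <;> rcases hy s with h2 | h2 <;> rw [h1, h2] <;> norm_num <;>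
    field_simp

lemma phat_mem_Icc {t : ℕ} (hZ : ∀ s ∈ Finset.Ico 1 t, ∀ j, Z s j = 1 ∨ Z s j = -1)
    (hy : ∀ s, y s = 1 ∨ y s = -1) (j : Fin K) (a : ℝ) :
    phat c Z y t j a ∈ Set.Icc (0 : ℝ) 1 := by
  by_cases h : numPaid c t j a = 0
  · simp [phat, h]
  · rw [phat_eq c hZ hy h]
    refine ⟨by positivity, div_le_one_of_le₀ ?_ (by positivity)⟩
    exact_mod_cast numCorrect_le c Z y t j a

variable (Z y)

/-- The wealth of a gambler who multiplies it in each round with payment `a` to expert `j` by `A`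
or `B` according to whether the expert is correct. -/
noncomputable def wealth (A B : ℝ) (j : Fin K) (a : ℝ) (t : ℕ) : ℝ :=
  ∏ s ∈ Finset.Ico 1 t, if c s j = a then (if Z s j = y s then A else B) else 1

lemma wealth_eq (A B : ℝ) (j : Fin K) (a : ℝ) (t : ℕ) :
    wealth c Z y A B j a t = A ^ numCorrect c Z y t j a *
      B ^ (numPaid c t j a - numCorrect c Z y t j a) := by
  rw [wealth, ← Finset.prod_filter, Finset.prod_ite, Finset.prod_const, Finset.prod_const,
    Finset.filter_filter]
  congr 2
  have := Finset.card_filter_add_card_filter_not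
    (s := (Finset.Ico 1 t).filter (fun s => c s j = a)) (fun s => Z s j = y s)
  rw [Finset.filter_filter, Finset.filter_filter] at this
  rw [numPaid, numCorrect, ← this, Finset.filter_filter, Nat.add_sub_cancel_left]

lemma wealth_succ (A B : ℝ) (j : Fin K) (a : ℝ) {t : ℕ} (ht : 1 ≤ t) :
    wealth c Z y A B j a (t + 1) = wealth c Z y A B j a t *
      if c t j = a then (if Z t j = y t then A else B) else 1 := by
  rw [wealth, Finset.prod_Ico_succ_top ht, wealth]

end Counting

section Measurability

variable {Ω : Type*} {m : MeasurableSpace Ω} {K : ℕ} {c Z : ℕ → Ω → Fin K → ℝ} {y : ℕ → ℝ} {t : ℕ}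

lemma measurableSet_payment_eq {s : ℕ} (hc : Measurable (c s)) (j : Fin K)
    {a : Ω → ℝ} (ha : Measurable a) : MeasurableSet {ω | c s ω j = a ω} :=
  measurableSet_eq_fun ((measurable_pi_apply j).comp hc) ha

lemma measurable_numPaid (hc : ∀ s ∈ Finset.Ico 1 t, Measurable (c s)) (j : Fin K)
    {a : Ω → ℝ} (ha : Measurable a) :
    Measurable fun ω => numPaid (fun s => c s ω) t j (a ω) := by
  simp only [numPaid, Finset.card_filter]
  exact Finset.measurable_fun_sum _ fun s hs =>
    Measurable.ite (measurableSet_payment_eq (hc s hs) j ha) measurable_const measurable_const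

lemma measurable_phat (hc : ∀ s ∈ Finset.Ico 1 t, Measurable (c s))
    (hZ : ∀ s ∈ Finset.Ico 1 t, Measurable (Z s)) (j : Fin K)
    {a : Ω → ℝ} (ha : Measurable a) :
    Measurable fun ω => phat (fun s => c s ω) (fun s => Z s ω) y t j (a ω) := by
  have hn := measurable_numPaid hc j ha
  simp only [phat, Finset.sum_filter]
  refine Measurable.ite (hn (measurableSet_singleton 0)) measurable_const ?_
  refine Finset.measurable_fun_sum _ fun s hs =>
    Measurable.ite (measurableSet_payment_eq (hc s hs) j ha) ?_ measurable_const
  have hz : Measurable fun ω => Z s ω j := (measurable_pi_apply j).comp (hZ s hs)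
  have hn' : Measurable fun ω => (numPaid (fun s => c s ω) t j (a ω) : ℝ) :=
    measurable_from_top.comp hn
  fun_prop

lemma measurable_wealth (hc : ∀ s ∈ Finset.Ico 1 t, Measurable (c s))
    (hZ : ∀ s ∈ Finset.Ico 1 t, Measurable (Z s)) (A B : ℝ) (j : Fin K) (a : ℝ) :
    Measurable fun ω => wealth (fun s => c s ω) (fun s => Z s ω) y A B j a t := by
  simp only [wealth]
  refine Finset.measurable_fun_prod _ fun s hs =>
    Measurable.ite (measurableSet_payment_eq (hc s hs) j measurable_const)
      (Measurable.ite ?_ measurable_const measurable_const) measurable_const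
  exact measurableSet_eq_fun ((measurable_pi_apply j).comp (hZ s hs)) measurable_const

lemma measurable_radius {n : Ω → ℕ} {q : Ω → ℝ} (hn : Measurable n) (hq : Measurable q) (ℓ : ℝ) :
    Measurable fun ω => radius ℓ (n ω) (q ω) := by
  have hn' : Measurable fun ω => (n ω : ℝ) := measurable_from_top.comp hn
  unfold radius
  fun_prop

/-- At the beginning of round `t`, the confidence intervals of all payments in `C` that have been
tried contain the true success probabilities. -/
def goodEvent (C : Finset ℝ) (ℓ : ℝ) (p : Fin K → ℝ → ℝ) (y : ℕ → ℝ) (c Z : ℕ → Ω → Fin K → ℝ)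
    (t : ℕ) : Set Ω :=
  {ω | ∀ j, ∀ a ∈ C, numPaid (fun s => c s ω) t j a ≠ 0 →
    |phat (fun s => c s ω) (fun s => Z s ω) y t j a - p j a| ≤
      radius ℓ (numPaid (fun s => c s ω) t j a)
        (phat (fun s => c s ω) (fun s => Z s ω) y t j a)}

lemma measurableSet_goodEvent (hc : ∀ s ∈ Finset.Ico 1 t, Measurable (c s))
    (hZ : ∀ s ∈ Finset.Ico 1 t, Measurable (Z s)) (C : Finset ℝ) (ℓ : ℝ) (p : Fin K → ℝ → ℝ) :
    MeasurableSet (goodEvent C ℓ p y c Z t) := by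
  have hn := fun j (a : ℝ) => measurable_numPaid hc j (measurable_const (a := a))
  have hq := fun j (a : ℝ) => measurable_phat (y := y) hc hZ j (measurable_const (a := a))
  have heq : goodEvent C ℓ p y c Z t = ⋂ j, ⋂ a ∈ C,
      ({ω | numPaid (fun s => c s ω) t j a = 0} ∪
      {ω | |phat (fun s => c s ω) (fun s => Z s ω) y t j a - p j a| ≤
        radius ℓ (numPaid (fun s => c s ω) t j a)
          (phat (fun s => c s ω) (fun s => Z s ω) y t j a)}) := by
    ext ω
    simp only [goodEvent, Set.mem_iInter, Set.mem_union, Set.mem_ofPred_eq, or_iff_not_imp_left,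
      ne_eq]
  rw [heq]
  refine MeasurableSet.iInter fun j => Finset.measurableSet_biInter _ fun a _ =>
    MeasurableSet.union (hn j a (measurableSet_singleton 0)) ?_
  exact measurableSet_le ((hq j a).sub_const _).abs (measurable_radius (hn j a) (hq j a) ℓ)

end Measurability

section Signs

/-- The set `{-1, 1}^K`. -/
noncomputable def signs (K : ℕ) : Finset (Fin K → ℝ) :=
  Fintype.piFinset fun _ => {1, -1}

variable {K : ℕ}

lemma mem_signs {z : Fin K → ℝ} : z ∈ signs K ↔ ∀ j, z j = 1 ∨ z j = -1 := by
  simp [signs, Fintype.mem_piFinset]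

/-- The probability of the advice `z` if the label is `y` and expert `j` is correct with
probability `q j`. -/
noncomputable def adviceProb (y : ℝ) (q z : Fin K → ℝ) : ℝ := ∏ j, if z j = y then q j else 1 - q j

lemma sum_prod_mul_adviceProb {y : ℝ} (hy : y = 1 ∨ y = -1) (q : Fin K → ℝ)
    (h : Fin K → ℝ → ℝ) :
    ∑ z ∈ signs K, (∏ j, h j (z j)) * adviceProb y q z =
      ∏ j, (h j y * q j + h j (-y) * (1 - q j)) := by
  simp only [adviceProb, ← Finset.prod_mul_distrib]
  rw [signs, ← Finset.prod_univ_sum (fun _ : Fin K => ({1, -1} : Finset ℝ))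
    (fun j x => h j x * if x = y then q j else 1 - q j)]
  apply Finset.prod_congr rfl
  intro j _
  rw [Finset.sum_pair (by norm_num)]
  rcases hy with rfl | rfl
  · norm_num
  · norm_num [add_comm]

lemma sum_mul_adviceProb {y : ℝ} (hy : y = 1 ∨ y = -1) (q : Fin K → ℝ) (i : Fin K) (u : ℝ → ℝ) :
    ∑ z ∈ signs K, u (z i) * adviceProb y q z = u y * q i + u (-y) * (1 - q i) := by
  have h := sum_prod_mul_adviceProb hy q (fun j x => if j = i then u x else 1)
  simp only [Finset.prod_ite_eq', Finset.mem_univ, if_true] at h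
  rw [h, Finset.prod_eq_single i]
  · simp
  · intro j _ hj
    simp [hj]
  · simp

lemma adviceProb_nonneg (y : ℝ) {q : Fin K → ℝ} (hq : ∀ j, q j ∈ Set.Icc (0 : ℝ) 1)
    (z : Fin K → ℝ) : 0 ≤ adviceProb y q z :=
  Finset.prod_nonneg fun j _ => by
    split_ifs
    · exact (hq j).1
    · linarith [(hq j).2]

end Signs

section Concentration

variable {Ω : Type*} {mΩ : MeasurableSpace Ω} {μ : Measure Ω}
  {ℱ : Filtration ℕ mΩ} {K T : ℕ} {p : Fin K → ℝ → ℝ} {y : ℕ → ℝ} {c Z : ℕ → Ω → Fin K → ℝ}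
  {yhat : ℕ → Ω → ℝ}

namespace IsProtocol

lemma measurable_payment (hprot : IsProtocol μ ℱ T p y c Z yhat) {t : ℕ} (ht : t ≤ T + 1) :
    ∀ s ∈ Finset.Ico 1 t, Measurable[ℱ t] (c s) := fun s hs => by
  have := Finset.mem_Ico.1 hs
  exact (hprot.payment_measurable s (Finset.mem_Icc.2 ⟨this.1, by omega⟩)).mono
    (ℱ.mono (by omega)) le_rfl

lemma measurable_advice (hprot : IsProtocol μ ℱ T p y c Z yhat) {t : ℕ} (ht : t ≤ T + 1) :
    ∀ s ∈ Finset.Ico 1 t, Measurable[ℱ t] (Z s) := fun s hs => by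
  have := Finset.mem_Ico.1 hs
  exact (hprot.advice_measurable s (Finset.mem_Icc.2 ⟨this.1, by omega⟩)).mono
    (ℱ.mono (by omega)) le_rfl

lemma advice_eq_or (hprot : IsProtocol μ ℱ T p y c Z yhat) {t : ℕ} (ht : t ≤ T + 1) (ω : Ω) :
    ∀ s ∈ Finset.Ico 1 t, ∀ j, Z s ω j = 1 ∨ Z s ω j = -1 := fun s hs j => by
  have := Finset.mem_Ico.1 hs
  exact hprot.advice_binary s (Finset.mem_Icc.2 ⟨this.1, by omega⟩) ω j

variable [IsProbabilityMeasure μ]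

/-- Integration over the advice of round `t`, given the past. -/
lemma integral_advice_le (hprot : IsProtocol μ ℱ T p y c Z yhat) {t : ℕ}
    (ht : t ∈ Finset.Icc 1 T) {f : (Fin K → ℝ) → Ω → ℝ} (hf : ∀ z, Measurable[ℱ t] (f z))
    {b : ℝ} (hb : ∀ z ω, |f z ω| ≤ b) {g : Ω → ℝ} (hg : Integrable g μ)
    (h : ∀ ω, ∑ z ∈ signs K, f z ω * adviceProb (y t) (fun j => p j (c t ω j)) z ≤ g ω) :
    ∫ ω, f (Z t ω) ω ∂μ ≤ ∫ ω, g ω ∂μ := by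
  have hZm : Measurable (Z t) := (hprot.advice_measurable t ht).mono (ℱ.le _) le_rfl
  let I : (Fin K → ℝ) → Ω → ℝ := fun z => Set.indicator {ω | Z t ω = z} fun _ => (1 : ℝ)
  have hIint : ∀ z, Integrable (I z) μ := fun z =>
    (integrable_const (1 : ℝ)).indicator (hZm (measurableSet_singleton z))
  have hsum : ∀ ω, f (Z t ω) ω = ∑ z ∈ signs K, f z ω * I z ω := by
    intro ω
    rw [Finset.sum_eq_single (Z t ω)]
    · simp [I]
    · intro z _ hz
      have : ω ∉ {ω | Z t ω = z} := fun h => hz h.symm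
      simp only [I, Set.indicator_of_notMem this, mul_zero]
    · intro hn
      exact absurd (mem_signs.2 (hprot.advice_binary t ht ω)) hn
  have hfI : ∀ z, Integrable (fun ω => f z ω * I z ω) μ := fun z =>
    (hIint z).bdd_mul ((hf z).mono (ℱ.le _) le_rfl).aestronglyMeasurable
      (Filter.Eventually.of_forall fun ω => hb z ω)
  have hcond : ∀ z, μ[fun ω => f z ω * I z ω | ℱ t] =ᵐ[μ] fun ω => f z ω * (μ[I z | ℱ t]) ω :=
    fun z => condExp_mul_of_stronglyMeasurable_left (hf z).stronglyMeasurable (hfI z) (hIint z)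
  have hfc : ∀ z, Integrable (fun ω => f z ω * (μ[I z | ℱ t]) ω) μ := fun z =>
    integrable_condExp.congr (hcond z)
  calc ∫ ω, f (Z t ω) ω ∂μ = ∑ z ∈ signs K, ∫ ω, f z ω * I z ω ∂μ := by
        simp_rw [hsum]
        exact integral_finsetSum _ fun z _ => hfI z
    _ = ∑ z ∈ signs K, ∫ ω, f z ω * (μ[I z | ℱ t]) ω ∂μ := by
        refine Finset.sum_congr rfl fun z _ => ?_
        rw [← integral_condExp (ℱ.le t), integral_congr_ae (hcond z)]
    _ = ∫ ω, ∑ z ∈ signs K, f z ω * (μ[I z | ℱ t]) ω ∂μ :=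
        (integral_finsetSum _ fun z _ => hfc z).symm
    _ ≤ ∫ ω, g ω ∂μ := by
        refine integral_mono_ae (integrable_finsetSum _ fun z _ => hfc z) hg ?_
        have hall : ∀ᵐ ω ∂μ, ∀ z ∈ signs K,
            (μ[I z | ℱ t]) ω = adviceProb (y t) (fun j => p j (c t ω j)) z :=
          (Finset.eventually_all _).2 fun z hz =>
            hprot.advice_law t ht z (mem_signs.1 hz)
        filter_upwards [hall] with ω hω
        refine le_trans (le_of_eq ?_) (h ω)
        exact Finset.sum_congr rfl fun z hz => by rw [hω z hz]

lemma abs_wealth_le {A B : ℝ} (hA : 0 ≤ A) (hB : 0 ≤ B) (c Z : ℕ → Fin K → ℝ) (y : ℕ → ℝ)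
    (j : Fin K) (a : ℝ) (t : ℕ) : |wealth c Z y A B j a t| ≤ (1 + A + B) ^ (t - 1) := by
  rw [wealth, Finset.abs_prod]
  calc _ ≤ ∏ _s ∈ Finset.Ico 1 t, (1 + A + B) := by
        refine Finset.prod_le_prod (fun _ _ => abs_nonneg _) fun s _ => ?_
        split_ifs
        · rw [abs_of_nonneg hA]; linarith
        · rw [abs_of_nonneg hB]; linarith
        · rw [abs_one]; linarith
    _ = _ := by simp

lemma wealth_nonneg {A B : ℝ} (hA : 0 ≤ A) (hB : 0 ≤ B) (c Z : ℕ → Fin K → ℝ) (y : ℕ → ℝ)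
    (j : Fin K) (a : ℝ) (t : ℕ) : 0 ≤ wealth c Z y A B j a t := by
  rw [wealth_eq]; positivity

lemma integrable_wealth (hprot : IsProtocol μ ℱ T p y c Z yhat) {A B : ℝ} (hA : 0 ≤ A)
    (hB : 0 ≤ B) (j : Fin K) (a : ℝ) {t : ℕ} (ht : t ≤ T + 1) :
    Integrable (fun ω => wealth (fun s => c s ω) (fun s => Z s ω) y A B j a t) μ := by
  refine Integrable.of_bound (C := (1 + A + B) ^ (t - 1)) ?_ (Filter.Eventually.of_forall fun ω =>
    abs_wealth_le hA hB _ _ y j a t)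
  exact ((measurable_wealth (m := ℱ t) (hprot.measurable_payment ht) (hprot.measurable_advice ht)
    A B j a).mono (ℱ.le t) le_rfl).aestronglyMeasurable

/-- Bets that are not favourable gain nothing in expectation. -/
lemma integral_wealth_le (hprot : IsProtocol μ ℱ T p y c Z yhat) (hy : ∀ t, y t = 1 ∨ y t = -1)
    {A B : ℝ} (hA : 0 ≤ A) (hB : 0 ≤ B) {j : Fin K} {a : ℝ}
    (hAB : p j a * A + (1 - p j a) * B ≤ 1) {t : ℕ} (ht1 : 1 ≤ t) (ht : t ≤ T + 1) :
    ∫ ω, wealth (fun s => c s ω) (fun s => Z s ω) y A B j a t ∂μ ≤ 1 := by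
  induction t, ht1 using Nat.le_induction with
  | base => simp [wealth]
  | succ t ht1 ih =>
    have htT : t ≤ T + 1 := by omega
    have htm : t ∈ Finset.Icc 1 T := Finset.mem_Icc.2 ⟨ht1, by omega⟩
    refine le_trans ?_ (ih htT)
    simp only [wealth_succ _ _ _ A B j a ht1]
    have hW := measurable_wealth (m := ℱ t) (y := y) (hprot.measurable_payment htT)
      (hprot.measurable_advice htT) A B j a
    refine hprot.integral_advice_le htm
      (f := fun z ω => wealth (fun s => c s ω) (fun s => Z s ω) y A B j a t *
        if c t ω j = a then (if z j = y t then A else B) else 1)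
      (b := (1 + A + B) ^ (t - 1) * (1 + A + B)) (fun z => ?_) (fun z ω => ?_)
      (hprot.integrable_wealth hA hB j a htT) (fun ω => ?_)
    · refine hW.mul (Measurable.ite ?_ measurable_const measurable_const)
      exact measurableSet_payment_eq (hprot.payment_measurable t htm) j measurable_const
    · rw [abs_mul]
      refine mul_le_mul (abs_wealth_le hA hB _ _ y j a t) ?_ (abs_nonneg _) (by positivity)
      split_ifs
      · rw [abs_of_nonneg hA]; linarith
      · rw [abs_of_nonneg hB]; linarith
      · rw [abs_one]; linarith
    · simp only [mul_assoc]
      rw [← Finset.mul_sum, sum_mul_adviceProb (hy t) _ j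
        (fun x => if c t ω j = a then (if x = y t then A else B) else 1)]
      refine mul_le_of_le_one_right (wealth_nonneg hA hB _ _ y j a t) ?_
      have hne : ¬ -y t = y t := by
        rcases hy t with h | h <;> rw [h] <;> norm_num
      by_cases hca : c t ω j = a
      · simp only [hca, if_true, hne, if_false]
        linarith
      · simp only [hca, if_false]
        linarith

lemma measure_le_wealth (hprot : IsProtocol μ ℱ T p y c Z yhat) (hy : ∀ t, y t = 1 ∨ y t = -1)
    {A B : ℝ} (hA : 0 ≤ A) (hB : 0 ≤ B) {j : Fin K} {a : ℝ}
    (hAB : p j a * A + (1 - p j a) * B ≤ 1) {t : ℕ} (ht1 : 1 ≤ t) (ht : t ≤ T + 1) (ℓ : ℝ) :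
    μ.real {ω | Real.exp ℓ ≤ wealth (fun s => c s ω) (fun s => Z s ω) y A B j a t} ≤
      Real.exp (-ℓ) := by
  have h := mul_meas_ge_le_integral_of_nonneg
    (Filter.Eventually.of_forall fun ω => wealth_nonneg hA hB (fun s => c s ω) (fun s => Z s ω)
      y j a t) (hprot.integrable_wealth hA hB j a ht) (Real.exp ℓ)
  have h2 := h.trans (hprot.integral_wealth_le hy hA hB hAB ht1 ht)
  rw [Real.exp_neg, ← one_div, le_div_iff₀' (Real.exp_pos ℓ)]
  exact h2

/-- The confidence interval of radius `radius ℓ n p̂` fails with probability at most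
`2 exp (-ℓ)` for each number of observations `n`. -/
lemma measure_numPaid_eq_and_radius_lt (hprot : IsProtocol μ ℱ T p y c Z yhat)
    (hy : ∀ t, y t = 1 ∨ y t = -1) {ℓ : ℝ} (hℓ : 0 < ℓ) {j : Fin K} {a : ℝ}
    (hp : p j a ∈ Set.Icc (0 : ℝ) 1) {t n : ℕ} (ht1 : 1 ≤ t) (ht : t ≤ T + 1) (hn : 0 < n) :
    μ.real {ω | numPaid (fun s => c s ω) t j a = n ∧
      radius ℓ n (phat (fun s => c s ω) (fun s => Z s ω) y t j a) <
        |phat (fun s => c s ω) (fun s => Z s ω) y t j a - p j a|} ≤ 2 * Real.exp (-ℓ) := by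
  obtain ⟨A, B, hA, hB, hAB, hbet⟩ := exists_bet hℓ hp.2 hn
  obtain ⟨A', B', hA', hB', hAB', hbet'⟩ := exists_bet' hℓ hp.1 hn
  have hsub : {ω | numPaid (fun s => c s ω) t j a = n ∧
      radius ℓ n (phat (fun s => c s ω) (fun s => Z s ω) y t j a) <
        |phat (fun s => c s ω) (fun s => Z s ω) y t j a - p j a|} ⊆
      {ω | Real.exp ℓ ≤ wealth (fun s => c s ω) (fun s => Z s ω) y A B j a t} ∪
      {ω | Real.exp ℓ ≤ wealth (fun s => c s ω) (fun s => Z s ω) y A' B' j a t} := by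
    rintro ω ⟨h1, h2⟩
    have hle := numCorrect_le (fun s => c s ω) (fun s => Z s ω) y t j a
    rw [phat_eq _ (hprot.advice_eq_or ht ω) hy (by omega), h1] at h2
    rw [h1] at hle
    rcases lt_abs.1 h2 with h3 | h3
    · right
      change Real.exp ℓ ≤ wealth _ _ _ _ _ _ _ _
      rw [wealth_eq, h1]
      exact hbet' _ hle (by linarith)
    · left
      change Real.exp ℓ ≤ wealth _ _ _ _ _ _ _ _
      rw [wealth_eq, h1]
      exact hbet _ hle (by linarith)
  calc _ ≤ _ := measureReal_mono hsub
    _ ≤ _ := measureReal_union_le _ _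
    _ ≤ Real.exp (-ℓ) + Real.exp (-ℓ) :=
        add_le_add (hprot.measure_le_wealth hy hA hB hAB ht1 ht ℓ)
          (hprot.measure_le_wealth hy hA' hB' hAB' ht1 ht ℓ)
    _ = _ := by ring

lemma measure_compl_goodEvent_le (hprot : IsProtocol μ ℱ T p y c Z yhat)
    (hy : ∀ t, y t = 1 ∨ y t = -1) {C : Finset ℝ} {ℓ : ℝ} (hℓ : 0 < ℓ)
    (hp : ∀ j, ∀ a ∈ C, p j a ∈ Set.Icc (0 : ℝ) 1) {t : ℕ} (ht : t ∈ Finset.Icc 1 T) :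
    μ.real (goodEvent C ℓ p y c Z t)ᶜ ≤ K * C.card * T * (2 * Real.exp (-ℓ)) := by
  obtain ⟨ht1, htT⟩ := Finset.mem_Icc.1 ht
  let bad : Fin K → ℝ → ℕ → Set Ω := fun j a n => {ω | numPaid (fun s => c s ω) t j a = n ∧
      radius ℓ n (phat (fun s => c s ω) (fun s => Z s ω) y t j a) <
        |phat (fun s => c s ω) (fun s => Z s ω) y t j a - p j a|}
  have hsub : (goodEvent C ℓ p y c Z t)ᶜ ⊆
      ⋃ i ∈ (Finset.univ ×ˢ C ×ˢ Finset.Icc 1 T : Finset (Fin K × ℝ × ℕ)),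
        bad i.1 i.2.1 i.2.2 := by
    intro ω hω
    have hω : ¬ ∀ j, ∀ a ∈ C, _ := hω
    push Not at hω
    obtain ⟨j, a, ha, hn, hlt⟩ := hω
    have hle := numPaid_le (fun s => c s ω) t j a
    simp only [Set.mem_iUnion]
    refine ⟨(j, a, numPaid (fun s => c s ω) t j a), ?_, rfl, hlt⟩
    simp only [Finset.mem_product, Finset.mem_univ, true_and, Finset.mem_Icc]
    exact ⟨ha, by omega, by omega⟩
  calc _ ≤ _ := measureReal_mono hsub (measure_ne_top _ _)
    _ ≤ _ := measureReal_biUnion_finset_le _ _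
    _ ≤ ∑ _i ∈ (Finset.univ ×ˢ C ×ˢ Finset.Icc 1 T : Finset (Fin K × ℝ × ℕ)),
        2 * Real.exp (-ℓ) := by
        refine Finset.sum_le_sum fun i hi => ?_
        simp only [Finset.mem_product, Finset.mem_univ, true_and, Finset.mem_Icc] at hi
        exact hprot.measure_numPaid_eq_and_radius_lt hy hℓ (hp _ _ hi.1) ht1 (by omega)
          (by omega)
    _ = _ := by
        simp only [Finset.sum_const, Finset.card_product, Finset.card_univ, Fintype.card_fin,
          Nat.card_Icc, Nat.add_sub_cancel, nsmul_eq_mul]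
        push_cast
        ring

end IsProtocol

end Concentration

section ErrorBound

/-- The error probability of the randomized prediction with vote `x` if the label is `y`. -/
noncomputable def gapError (y x : ℝ) : ℝ :=
  if sgn x = y then 1 / 2 * Real.exp (-(x * sgn x)) else 1 - 1 / 2 * Real.exp (-(x * sgn x))

lemma gapError_mem_Icc (y x : ℝ) : gapError y x ∈ Set.Icc (0 : ℝ) 1 := by
  have h1 : Real.exp (-(x * sgn x)) ≤ 1 := by
    rw [mul_sgn]; exact Real.exp_le_one_iff.2 (by simp)
  have h2 := Real.exp_pos (-(x * sgn x))
  unfold gapError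
  split_ifs <;> constructor <;> linarith

lemma gapError_le {y : ℝ} (hy : y = 1 ∨ y = -1) (x : ℝ) :
    gapError y x ≤ 1 / 2 * Real.exp (-(y * x)) := by
  unfold gapError
  split_ifs with h
  · rw [h, mul_comm x y]
  · have h1 : sgn x = -y := by
      rcases hy with rfl | rfl <;> rcases sgn_eq_or x with h2 | h2 <;> simp_all
    rw [h1, mul_neg, neg_neg, mul_comm x y]
    have h2 := Real.one_le_cosh (y * x)
    rw [Real.cosh_eq] at h2
    linarith

variable {K : ℕ}

/-- A bound for the error probability given the past and the advice `z`, in terms of the numbers of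
observations `n` and the estimates `q`. -/
noncomputable def errorBound (y β : ℝ) (n : Fin K → ℕ) (q z : Fin K → ℝ) : ℝ :=
  open Classical in
  if ∃ j, (n j : ℝ) < 2 * β then 1
  else if ∀ j, q j ∈ Set.Icc (β / n j) (1 - β / n j) then
    gapError y (∑ j, (1 / 2 * Real.log (q j / (1 - q j))) * z j)
  else ∑ j, if q j ∈ Set.Icc (β / n j) (1 - β / n j) then 0
    else if sgn (q j - 1 / 2) * z j = y then 0 else 1

lemma errorBound_nonneg (y β : ℝ) (n : Fin K → ℕ) (q z : Fin K → ℝ) :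
    0 ≤ errorBound y β n q z := by
  unfold errorBound
  split_ifs
  · exact zero_le_one
  · exact (gapError_mem_Icc _ _).1
  · exact Finset.sum_nonneg fun j _ => by split_ifs <;> norm_num

lemma errorBound_le (y β : ℝ) (n : Fin K → ℕ) (q z : Fin K → ℝ) :
    errorBound y β n q z ≤ K + 1 := by
  have hK : (0 : ℝ) ≤ K := by positivity
  unfold errorBound
  split_ifs
  · linarith
  · linarith [(gapError_mem_Icc y (∑ j, (1 / 2 * Real.log (q j / (1 - q j))) * z j)).2]
  · calc _ ≤ ∑ _j : Fin K, (1 : ℝ) := Finset.sum_le_sum fun j _ => by split_ifs <;> norm_num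
      _ ≤ _ := by simp

lemma sum_adviceProb {y : ℝ} (hy : y = 1 ∨ y = -1) (q : Fin K → ℝ) :
    ∑ z ∈ signs K, adviceProb y q z = 1 := by
  simpa using sum_prod_mul_adviceProb hy q (fun _ _ => 1)

/-- The error bound of estimates in range. -/
lemma sum_gapError_le {y ℓ : ℝ} (hy : y = 1 ∨ y = -1) (hℓ : 0 < ℓ) {n : Fin K → ℕ}
    {q p Q : Fin K → ℝ} (hn : ∀ j, 0 < n j) (hp : ∀ j, p j ∈ Set.Icc (0 : ℝ) 1)
    (hqp : ∀ j, |q j - p j| ≤ radius ℓ (n j) (q j)) (hQ0 : ∀ j, 0 ≤ Q j)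
    (hQ : ∀ j, Q j ≤ radius ℓ (n j) (q j))
    (hq : ∀ j, q j ∈ Set.Icc (18 * ℓ * (K : ℝ) ^ 2 / n j) (1 - 18 * ℓ * (K : ℝ) ^ 2 / n j)) :
    ∑ z ∈ signs K, gapError y (∑ j, (1 / 2 * Real.log (q j / (1 - q j))) * z j) *
      adviceProb y p z ≤ Phi (fun j => q j - sgn (1 / 2 - q j) * Q j) := by
  have hyy : y * y = 1 := by rcases hy with rfl | rfl <;> norm_num
  set w : Fin K → ℝ := fun j => 1 / 2 * Real.log (q j / (1 - q j)) with hw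
  have hexp : Real.exp (3 / 5) ≤ 2 := by
    rw [← Real.le_log_iff_exp_le (by norm_num)]
    linarith [Real.log_two_gt_d9]
  calc _ ≤ ∑ z ∈ signs K, 1 / 2 * ((∏ j, Real.exp (-(y * (w j * z j)))) * adviceProb y p z) := by
        refine Finset.sum_le_sum fun z _ => ?_
        rw [← mul_assoc, ← Real.exp_sum, Finset.sum_neg_distrib, ← Finset.mul_sum]
        exact mul_le_mul_of_nonneg_right (gapError_le hy _) (adviceProb_nonneg y hp z)
    _ = 1 / 2 * ∏ j, (p j * Real.exp (-w j) + (1 - p j) * Real.exp (w j)) := by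
        rw [← Finset.mul_sum, sum_prod_mul_adviceProb hy p
          (fun j x => Real.exp (-(y * (w j * x))))]
        congr 1
        refine Finset.prod_congr rfl fun j _ => ?_
        rw [show -(y * (w j * y)) = -w j by linear_combination (-w j) * hyy,
          show -(y * (w j * -y)) = w j by linear_combination (w j) * hyy]
        ring
    _ ≤ 1 / 2 * ∏ j, Real.exp (3 / 5 / (K : ℝ) -
          2 * (1 / 2 - (q j - sgn (1 / 2 - q j) * Q j)) ^ 2) := by
        refine mul_le_mul_of_nonneg_left (Finset.prod_le_prod (fun j _ => ?_) fun j _ => ?_)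
          (by norm_num)
        · have h1 := (hp j).1
          have h2 : 0 ≤ 1 - p j := by linarith [(hp j).2]
          positivity
        · have hK : (1 : ℝ) ≤ K := by
            exact_mod_cast (Nat.succ_le_of_lt (Nat.lt_of_le_of_lt (Nat.zero_le _) j.2))
          exact vote_factor_le hℓ hK (hn j) (hq j) (hqp j) (hQ0 j) (hQ j)
    _ = 1 / 2 * Real.exp (K * (3 / 5 / (K : ℝ))) *
          Phi (fun j => q j - sgn (1 / 2 - q j) * Q j) := by
        rw [← Real.exp_sum, Phi, mul_assoc, ← Real.exp_add, Finset.sum_sub_distrib,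
          ← Finset.mul_sum]
        simp only [Finset.sum_const, Finset.card_univ, Fintype.card_fin, nsmul_eq_mul]
        congr 2
        ring
    _ ≤ 1 * Phi (fun j => q j - sgn (1 / 2 - q j) * Q j) := by
        refine mul_le_mul_of_nonneg_right ?_ (Phi_nonneg _)
        have h1 : (K : ℝ) * (3 / 5 / K) ≤ 3 / 5 := by
          rcases Nat.eq_zero_or_pos K with h | h
          · simp [h]; norm_num
          · have : (K : ℝ) ≠ 0 := by exact_mod_cast h.ne'
            rw [mul_div_cancel₀ _ this]
        have := (Real.exp_le_exp.2 h1).trans hexp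
        linarith
    _ = _ := one_mul _

/-- The error bound of following an expert with an estimate out of range. -/
lemma follow_error_le {y ℓ β q p : ℝ} {n : ℕ} (hy : y = 1 ∨ y = -1) (hℓ : 0 < ℓ) (hβ : 0 ≤ β)
    (hn : 0 < n) (hnβ : 2 * β ≤ n) (hq : q ∈ Set.Icc (0 : ℝ) 1)
    (hqp : |q - p| ≤ radius ℓ n q) (hout : q ∉ Set.Icc (β / n) (1 - β / n)) :
    (if sgn (q - 1 / 2) * y = y then (0 : ℝ) else 1) * p +
      (if sgn (q - 1 / 2) * -y = y then (0 : ℝ) else 1) * (1 - p) ≤ (2 * β + 4 * ℓ) / n := by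
  have hn' : (0 : ℝ) < n := by exact_mod_cast hn
  have hhalf : β / n ≤ 1 / 2 := by
    rw [div_le_iff₀ hn']; linarith
  have habs := abs_le.1 hqp
  have hy1 : ¬ -y = y := by rcases hy with rfl | rfl <;> norm_num
  have hy2 : ¬ y = -y := fun h => hy1 h.symm
  by_cases h : q < β / n
  · have hs : sgn (q - 1 / 2) = -1 := by
      rw [sgn, if_neg (by linarith)]
    have := le_of_lt_div (p := p) hℓ hβ hn hq.1 h (by linarith)
    rw [hs]
    simp only [neg_mul, one_mul, neg_neg, hy1, if_false, if_true]
    linarith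
  · have h1 : 1 - β / n < q := by
      by_contra h2
      exact hout ⟨not_lt.1 h, not_lt.1 h2⟩
    have hs : sgn (q - 1 / 2) = 1 := by
      rw [sgn, if_pos (by linarith)]
    have := le_of_lt_div (p := 1 - p) (q := 1 - q) hℓ hβ hn (by linarith [hq.2]) (by linarith)
      (by rw [radius_one_sub]; linarith)
    rw [hs]
    simp only [one_mul, hy1, if_false, if_true]
    linarith

lemma sum_errorBound_le {y ℓ β : ℝ} (hy : y = 1 ∨ y = -1) (hℓ : 0 < ℓ)
    (hβ : β = 18 * ℓ * (K : ℝ) ^ 2) {n : Fin K → ℕ}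
    {q p Q : Fin K → ℝ} (hn : ∀ j, 0 < n j) (hp : ∀ j, p j ∈ Set.Icc (0 : ℝ) 1)
    (hq : ∀ j, q j ∈ Set.Icc (0 : ℝ) 1)
    (hqp : ∀ j, |q j - p j| ≤ radius ℓ (n j) (q j)) (hQ0 : ∀ j, 0 ≤ Q j)
    (hQ : ∀ j, Q j ≤ radius ℓ (n j) (q j)) :
    ∑ z ∈ signs K, errorBound y β n q z * adviceProb y p z ≤
      Phi (fun j => q j - sgn (1 / 2 - q j) * Q j) + ∑ j, (2 * β + 4 * ℓ) / n j := by
  have hβ0 : 0 ≤ β := by rw [hβ]; positivity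
  have hterm : ∀ j, 0 ≤ (2 * β + 4 * ℓ) / (n j : ℝ) := fun j => by positivity
  have hsum : 0 ≤ ∑ j, (2 * β + 4 * ℓ) / (n j : ℝ) := Finset.sum_nonneg fun j _ => hterm j
  have hPhi := Phi_nonneg fun j => q j - sgn (1 / 2 - q j) * Q j
  unfold errorBound
  by_cases h1 : ∃ j, (n j : ℝ) < 2 * β
  · simp only [if_pos h1, one_mul]
    rw [sum_adviceProb hy]
    obtain ⟨j, hj⟩ := h1
    have h2 : 1 ≤ (2 * β + 4 * ℓ) / (n j : ℝ) := by
      rw [le_div_iff₀ (by exact_mod_cast hn j)]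
      linarith
    have := Finset.single_le_sum (fun j _ => hterm j) (Finset.mem_univ j)
    linarith
  simp only [if_neg h1]
  by_cases h2 : ∀ j, q j ∈ Set.Icc (β / n j) (1 - β / n j)
  · simp only [if_pos h2]
    rw [hβ] at h2
    have := sum_gapError_le hy hℓ hn hp hqp hQ0 hQ h2
    linarith
  · simp only [if_neg h2, Finset.sum_mul]
    rw [Finset.sum_comm]
    refine le_add_of_nonneg_of_le hPhi (Finset.sum_le_sum fun j _ => ?_)
    by_cases h3 : q j ∈ Set.Icc (β / n j) (1 - β / n j)
    · simp only [if_pos h3, zero_mul, Finset.sum_const_zero]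
      exact hterm j
    · simp only [if_neg h3]
      rw [sum_mul_adviceProb hy p j (fun x => if sgn (q j - 1 / 2) * x = y then (0 : ℝ) else 1)]
      push Not at h1
      exact follow_error_le hy hℓ hβ0 (hn j) (h1 j) (hq j) (hqp j) h3

variable {Ω : Type*} {m : MeasurableSpace Ω}

lemma measurable_sgn : Measurable sgn :=
  Measurable.ite measurableSet_Ici measurable_const measurable_const

lemma measurable_gapError (y : ℝ) : Measurable (gapError y) := by
  have h : Measurable fun x : ℝ => 1 / 2 * Real.exp (-(x * sgn x)) :=
    ((measurable_id.mul measurable_sgn).neg.exp).const_mul _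
  exact Measurable.ite (measurableSet_eq_fun measurable_sgn measurable_const) h
    (measurable_const.sub h)

lemma measurable_vote_of {q z : Ω → Fin K → ℝ} (hq : ∀ j, Measurable fun ω => q ω j)
    (hz : Measurable z) :
    Measurable fun ω => ∑ j, (1 / 2 * Real.log (q ω j / (1 - q ω j))) * z ω j := by
  have hz' : ∀ j, Measurable fun ω => z ω j := fun j => (measurable_pi_apply j).comp hz
  refine Finset.measurable_fun_sum _ fun j _ => Measurable.mul ?_ (hz' j)
  exact (((hq j).div (measurable_const.sub (hq j))).log).const_mul _

lemma measurableSet_inRange {n : Ω → Fin K → ℕ} {q : Ω → Fin K → ℝ}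
    (hn : ∀ j, Measurable fun ω => n ω j) (hq : ∀ j, Measurable fun ω => q ω j) (β : ℝ)
    (j : Fin K) : MeasurableSet {ω | q ω j ∈ Set.Icc (β / n ω j) (1 - β / n ω j)} := by
  have hn' : Measurable fun ω => (n ω j : ℝ) := measurable_from_top.comp (hn j)
  exact (measurableSet_le (measurable_const.div hn') (hq j)).inter
    (measurableSet_le (hq j) (measurable_const.sub (measurable_const.div hn')))

lemma measurableSet_exists_lt {n : Ω → Fin K → ℕ} (hn : ∀ j, Measurable fun ω => n ω j) (b : ℝ) :
    MeasurableSet {ω | ∃ j, (n ω j : ℝ) < b} := by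
  have : {ω | ∃ j, (n ω j : ℝ) < b} = ⋃ j, {ω | (n ω j : ℝ) < b} := by ext ω; simp
  rw [this]
  exact MeasurableSet.iUnion fun j =>
    measurableSet_lt (measurable_from_top.comp (hn j)) measurable_const

lemma measurableSet_forall_inRange {n : Ω → Fin K → ℕ} {q : Ω → Fin K → ℝ}
    (hn : ∀ j, Measurable fun ω => n ω j) (hq : ∀ j, Measurable fun ω => q ω j) (β : ℝ) :
    MeasurableSet {ω | ∀ j, q ω j ∈ Set.Icc (β / n ω j) (1 - β / n ω j)} := by
  have : {ω | ∀ j, q ω j ∈ Set.Icc (β / n ω j) (1 - β / n ω j)} =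
      ⋂ j, {ω | q ω j ∈ Set.Icc (β / n ω j) (1 - β / n ω j)} := by ext ω; simp
  rw [this]
  exact MeasurableSet.iInter fun j => measurableSet_inRange hn hq β j

lemma measurable_errorBound (y β : ℝ) {n : Ω → Fin K → ℕ} {q z : Ω → Fin K → ℝ}
    (hn : ∀ j, Measurable fun ω => n ω j) (hq : ∀ j, Measurable fun ω => q ω j)
    (hz : Measurable z) : Measurable fun ω => errorBound y β (n ω) (q ω) (z ω) := by
  have hz' : ∀ j, Measurable fun ω => z ω j := fun j => (measurable_pi_apply j).comp hz
  unfold errorBound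
  refine Measurable.ite (measurableSet_exists_lt hn _) measurable_const
    (Measurable.ite (measurableSet_forall_inRange hn hq β)
      ((measurable_gapError y).comp (measurable_vote_of hq hz))
      (Finset.measurable_fun_sum _ fun j _ => Measurable.ite (measurableSet_inRange hn hq β j)
        measurable_const (Measurable.ite ?_ measurable_const measurable_const)))
  exact measurableSet_eq_fun ((measurable_sgn.comp ((hq j).sub_const _)).mul (hz' j))
    measurable_const

end ErrorBound

section Rounds

variable {Ω : Type*} {mΩ : MeasurableSpace Ω} {μ : Measure Ω}
  {ℱ : Filtration ℕ mΩ} {K T : ℕ} {p : Fin K → ℝ → ℝ} {y : ℕ → ℝ} {c Z : ℕ → Ω → Fin K → ℝ}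
  {yhat : ℕ → Ω → ℝ} {C : Finset ℝ} {lam L ε β δ : ℝ}

lemma measurable_count (hprot : IsProtocol μ ℱ T p y c Z yhat) {t : ℕ}
    (ht : t ∈ Finset.Icc 1 T) (j : Fin K) :
    Measurable[ℱ t] fun ω => numPaid (fun s => c s ω) t j (c t ω j) :=
  measurable_numPaid (m := ℱ t) (hprot.measurable_payment (by linarith [Finset.mem_Icc.1 ht])) j
    ((measurable_pi_apply j).comp (hprot.payment_measurable t ht))

lemma measurable_estimate (hprot : IsProtocol μ ℱ T p y c Z yhat) {t : ℕ}
    (ht : t ∈ Finset.Icc 1 T) (j : Fin K) :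
    Measurable[ℱ t] fun ω => phat (fun s => c s ω) (fun s => Z s ω) y t j (c t ω j) :=
  have ht' : t ≤ T + 1 := by linarith [Finset.mem_Icc.1 ht]
  measurable_phat (m := ℱ t) (hprot.measurable_payment ht') (hprot.measurable_advice ht') j
    ((measurable_pi_apply j).comp (hprot.payment_measurable t ht))

lemma measurable_error (hprot : IsProtocol μ ℱ T p y c Z yhat) {t : ℕ}
    (ht : t ∈ Finset.Icc 1 T) :
    Measurable fun ω => if yhat t ω ≠ y t then (1 : ℝ) else 0 := by
  have h : Measurable (yhat t) := (hprot.prediction_measurable t ht).mono (ℱ.le _) le_rfl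
  exact Measurable.ite (h (measurableSet_singleton (y t))).compl measurable_const measurable_const

/-- The range condition of the algorithm for payments that have been tried often. -/
lemma inRange_iff {c Z : ℕ → Fin K → ℝ} {y : ℕ → ℝ} {t : ℕ} {j : Fin K}
    (hn : 0 < numPaid c t j (c t j)) (h : 2 * β ≤ numPaid c t j (c t j)) :
    InRange c Z y β t j ↔ phat c Z y t j (c t j) ∈
      Set.Icc (β / numPaid c t j (c t j)) (1 - β / numPaid c t j (c t j)) := by
  have hn' : (0 : ℝ) < numPaid c t j (c t j) := by exact_mod_cast hn
  have : cutoff c β t j (c t j) = β / numPaid c t j (c t j) := by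
    rw [cutoff, if_neg hn.ne', min_eq_left]
    rw [div_le_iff₀ hn']
    linarith
  rw [InRange, this]

lemma numPaid_pos (halg : IsLCBGaptron μ ℱ T C lam β δ y c Z yhat) {t : ℕ}
    (ht : t ∈ Finset.Icc 1 T) (hCt : C.card < t) (ω : Ω) (j : Fin K) {a : ℝ} (ha : a ∈ C) :
    0 < numPaid (fun s => c s ω) t j a := by
  have hT := (Finset.mem_Icc.1 ht).2
  have hsub : ∀ s ∈ Finset.Icc 1 C.card, s ∈ Finset.Icc 1 T := fun s hs => by
    have := Finset.mem_Icc.1 hs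
    exact Finset.mem_Icc.2 ⟨this.1, by omega⟩
  exact numPaid_pos_of_explore (fun s => c s ω) hCt j
    (fun s hs => halg.payment_mem s (hsub s hs) ω j)
    (fun s hs => halg.explore s (hsub s hs) (Finset.mem_Icc.1 hs).2 ω j) ha

/-- The cost of a round is at most `1 + lam K`. -/
lemma cost_le (halg : IsLCBGaptron μ ℱ T C lam β δ y c Z yhat) (hlam : 0 < lam)
    (hC : ∀ a ∈ C, a ∈ Set.Icc (0 : ℝ) 1) {t : ℕ} (ht : t ∈ Finset.Icc 1 T) (ω : Ω) :
    (if yhat t ω ≠ y t then (1 : ℝ) else 0) + lam * ∑ j, c t ω j ≤ 1 + lam * K := by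
  have h1 : (if yhat t ω ≠ y t then (1 : ℝ) else 0) ≤ 1 := by split_ifs <;> norm_num
  have h2 : ∑ j, c t ω j ≤ ∑ _j : Fin K, (1 : ℝ) :=
    Finset.sum_le_sum fun j _ => (hC _ (halg.payment_mem t ht ω j)).2
  simp only [Finset.sum_const, Finset.card_univ, Fintype.card_fin, nsmul_eq_mul, mul_one] at h2
  gcongr

/-- On the good event the optimistic objective of the chosen payments is at most the optimum, up to
the discretization error. -/
lemma optimisticObjective_le (hprot : IsProtocol μ ℱ T p y c Z yhat)
    (halg : IsLCBGaptron μ ℱ T C lam β δ y c Z yhat) (hy : ∀ t, y t = 1 ∨ y t = -1)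
    (hp : ∀ j, ∀ a ∈ C, p j a ∈ Set.Icc (0 : ℝ) 1) {t : ℕ}
    (ht : t ∈ Finset.Icc 1 T) (hCt : C.card < t) {ω : Ω}
    (hω : ω ∈ goodEvent C (Real.log (3 / δ)) p y c Z t) {a : Fin K → ℝ} (ha : ∀ j, a j ∈ C) :
    optimisticObjective (fun s => c s ω) (fun s => Z s ω) y lam δ t (c t ω) ≤
      Phi (fun j => p j (a j)) + lam * ∑ j, a j := by
  have ht' : t ≤ T + 1 := by linarith [Finset.mem_Icc.1 ht]
  refine (halg.exploit t ht hCt ω a ha).trans ?_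
  unfold optimisticObjective
  gcongr
  refine Phi_le_of_sq_le fun j => ?_
  have hn := (numPaid_pos halg ht hCt ω j (ha j)).ne'
  rw [optimistic, if_neg hn]
  exact optimism (phat_mem_Icc _ (hprot.advice_eq_or ht' ω) hy j _) (hp j _ (ha j))
    (hω j _ (ha j) hn)

lemma sum_errorBound_le_of_goodEvent (hprot : IsProtocol μ ℱ T p y c Z yhat)
    (halg : IsLCBGaptron μ ℱ T C lam β δ y c Z yhat) (hy : ∀ t, y t = 1 ∨ y t = -1)
    (hℓ : 0 < Real.log (3 / δ)) (hβ : β = 18 * Real.log (3 / δ) * (K : ℝ) ^ 2)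
    (hp : ∀ j, ∀ a ∈ C, p j a ∈ Set.Icc (0 : ℝ) 1) {t : ℕ}
    (ht : t ∈ Finset.Icc 1 T) (hCt : C.card < t) {ω : Ω}
    (hω : ω ∈ goodEvent C (Real.log (3 / δ)) p y c Z t) {a : Fin K → ℝ} (ha : ∀ j, a j ∈ C) :
    ∑ z ∈ signs K, errorBound (y t) β (fun j => numPaid (fun s => c s ω) t j (c t ω j))
        (fun j => phat (fun s => c s ω) (fun s => Z s ω) y t j (c t ω j)) z *
          adviceProb (y t) (fun j => p j (c t ω j)) z ≤
      Phi (fun j => p j (a j)) + lam * ∑ j, a j - lam * ∑ j, c t ω j +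
        (2 * β + 4 * Real.log (3 / δ)) *
          ∑ j, (numPaid (fun s => c s ω) t j (c t ω j) : ℝ)⁻¹ := by
  have ht' : t ≤ T + 1 := by linarith [Finset.mem_Icc.1 ht]
  have hmem := halg.payment_mem t ht ω
  have hn := fun j => numPaid_pos halg ht hCt ω j (hmem j)
  have hq := fun j => phat_mem_Icc (fun s => c s ω) (hprot.advice_eq_or ht' ω) hy j (c t ω j)
  have h1 := sum_errorBound_le (hy t) hℓ hβ hn (fun j => hp j _ (hmem j)) hq
    (fun j => hω j _ (hmem j) (hn j).ne')
    (Q := fun j => width (fun s => c s ω) (fun s => Z s ω) y δ t j (c t ω j))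
    (fun j => le_min (le_min (by linarith [(hq j).2]) (hq j).1) (radius_nonneg hℓ _ _))
    (fun j => min_le_right _ _)
  have h2 := optimisticObjective_le hprot halg hy hp ht hCt hω ha
  have h3 : (fun j => optimistic (fun s => c s ω) (fun s => Z s ω) y δ t j (c t ω j)) =
      fun j => phat (fun s => c s ω) (fun s => Z s ω) y t j (c t ω j) -
        sgn (1 / 2 - phat (fun s => c s ω) (fun s => Z s ω) y t j (c t ω j)) *
          width (fun s => c s ω) (fun s => Z s ω) y δ t j (c t ω j) := by
    funext j
    rw [optimistic, if_neg (hn j).ne']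
  rw [optimisticObjective, h3] at h2
  simp only [div_eq_mul_inv (2 * β + 4 * Real.log (3 / δ)), ← Finset.mul_sum] at h1
  linarith

/-- The information at the moment when the learner predicts in round `t`: the past and the
advice. -/
abbrev pastAndAdvice (ℱ : Filtration ℕ mΩ) (Z : ℕ → Ω → Fin K → ℝ) (t : ℕ) : MeasurableSpace Ω :=
  ℱ t ⊔ MeasurableSpace.comap (Z t) inferInstance

variable [IsProbabilityMeasure μ]

lemma integrable_error (hprot : IsProtocol μ ℱ T p y c Z yhat) {t : ℕ}
    (ht : t ∈ Finset.Icc 1 T) :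
    Integrable (fun ω => if yhat t ω ≠ y t then (1 : ℝ) else 0) μ :=
  Integrable.of_bound (C := 1) (measurable_error hprot ht).aestronglyMeasurable
    (Filter.Eventually.of_forall fun ω => by split_ifs <;> norm_num)

/-- While all estimates are in range, the error probability given the past and the advice is given
by the vote. -/
lemma setIntegral_error_eq (hprot : IsProtocol μ ℱ T p y c Z yhat)
    (halg : IsLCBGaptron μ ℱ T C lam β δ y c Z yhat) (hy : ∀ t, y t = 1 ∨ y t = -1) {t : ℕ}
    (ht : t ∈ Finset.Icc 1 T) {E : Set Ω} (hE : MeasurableSet[ℱ t] E)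
    (hEr : ∀ ω ∈ E, ∀ j, InRange (fun s => c s ω) (fun s => Z s ω) y β t j) :
    ∫ ω in E, (if yhat t ω ≠ y t then (1 : ℝ) else 0) ∂μ =
      ∫ ω in E, gapError (y t) (vote (fun s => c s ω) (fun s => Z s ω) y t) ∂μ := by
  have hZm : Measurable (Z t) := (hprot.advice_measurable t ht).mono (ℱ.le _) le_rfl
  have hmle : pastAndAdvice ℱ Z t ≤ mΩ := sup_le (ℱ.le t) hZm.comap_le
  have hEm : MeasurableSet[pastAndAdvice ℱ Z t] E := (le_sup_left : ℱ t ≤ pastAndAdvice ℱ Z t) _ hE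
  have hyh : Measurable (yhat t) := (hprot.prediction_measurable t ht).mono (ℱ.le _) le_rfl
  set x : Ω → ℝ := fun ω => vote (fun s => c s ω) (fun s => Z s ω) y t with hx
  have hxm : Measurable[pastAndAdvice ℱ Z t] x :=
    measurable_vote_of (m := pastAndAdvice ℱ Z t)
      (q := fun ω j => phat (fun s => c s ω) (fun s => Z s ω) y t j (c t ω j)) (z := Z t)
      (fun j => (measurable_estimate hprot ht j).mono le_sup_left le_rfl)
      ((comap_measurable (Z t)).mono le_sup_right le_rfl)
  have hsx : Measurable[pastAndAdvice ℱ Z t] fun ω => sgn (x ω) := measurable_sgn.comp hxm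
  let a : Ω → ℝ := fun ω => if sgn (x ω) = y t then 1 else 0
  have ham : Measurable[pastAndAdvice ℱ Z t] a :=
    Measurable.ite (hsx (measurableSet_singleton (y t))) measurable_const measurable_const
  let b : Ω → ℝ := fun ω => 1 - 2 * a ω
  have hbm : Measurable[pastAndAdvice ℱ Z t] b := measurable_const.sub (ham.const_mul 2)
  have hab : ∀ ω, |a ω| ≤ 1 := fun ω => by simp only [a]; split_ifs <;> norm_num
  have hbb : ∀ ω, |b ω| ≤ 1 := fun ω => by simp only [b, a]; split_ifs <;> norm_num
  let S : Set Ω := {ω | yhat t ω = sgn (x ω)}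
  have hS : MeasurableSet S := measurableSet_eq_fun hyh (hsx.mono hmle le_rfl)
  let I : Ω → ℝ := S.indicator fun _ => (1 : ℝ)
  have hI : Integrable I μ := (integrable_const (1 : ℝ)).indicator hS
  have hai : Integrable a μ := Integrable.of_bound (C := 1)
    (ham.mono hmle le_rfl).aestronglyMeasurable (Filter.Eventually.of_forall hab)
  have hbI : Integrable (fun ω => b ω * I ω) μ := hI.bdd_mul
    (hbm.mono hmle le_rfl).aestronglyMeasurable (Filter.Eventually.of_forall hbb)
  have hcond : μ[fun ω => b ω * I ω | pastAndAdvice ℱ Z t] =ᵐ[μ]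
      fun ω => b ω * (μ[I | pastAndAdvice ℱ Z t]) ω :=
    condExp_mul_of_stronglyMeasurable_left hbm.stronglyMeasurable hbI hI
  have hbc : Integrable (fun ω => b ω * (μ[I | pastAndAdvice ℱ Z t]) ω) μ :=
    integrable_condExp.congr hcond
  have herr : ∀ ω, (if yhat t ω ≠ y t then (1 : ℝ) else 0) = a ω + b ω * I ω := by
    intro ω
    by_cases hω : yhat t ω = sgn (x ω)
    · have h1 : I ω = 1 := Set.indicator_of_mem (show ω ∈ S from hω) _
      rw [h1, hω]
      simp only [b, a]
      by_cases h2 : sgn (x ω) = y t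
      · simp only [h2, ne_eq, not_true_eq_false, if_false, if_true]; norm_num
      · simp only [h2, ne_eq, not_false_eq_true, if_false, if_true]; norm_num
    · have h1 : I ω = 0 := Set.indicator_of_notMem (show ω ∉ S from hω) _
      rw [h1, mul_zero, add_zero]
      simp only [a]
      have h3 : yhat t ω ≠ y t ↔ sgn (x ω) = y t := by
        rcases hprot.prediction_binary t ht ω with hp1 | hp1 <;> rcases hy t with hy1 | hy1 <;>
          rcases sgn_eq_or (x ω) with hs1 | hs1 <;> rw [hp1, hs1] at hω <;>
          rw [hp1, hy1, hs1] <;> first | exact absurd rfl hω | norm_num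
      by_cases h2 : sgn (x ω) = y t
      · rw [if_pos (h3.2 h2), if_pos h2]
      · rw [if_neg (mt h3.1 h2), if_neg h2]
  calc ∫ ω in E, (if yhat t ω ≠ y t then (1 : ℝ) else 0) ∂μ
      = ∫ ω in E, a ω ∂μ + ∫ ω in E, b ω * I ω ∂μ := by
        simp_rw [herr]
        exact integral_add hai.integrableOn hbI.integrableOn
    _ = ∫ ω in E, a ω ∂μ + ∫ ω in E, b ω * (μ[I | pastAndAdvice ℱ Z t]) ω ∂μ := by
        rw [← setIntegral_condExp hmle hbI hEm]
        congr 1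
        exact integral_congr_ae (ae_restrict_of_ae hcond)
    _ = ∫ ω in E, (a ω + b ω * (μ[I | pastAndAdvice ℱ Z t]) ω) ∂μ :=
        (integral_add hai.integrableOn hbc.integrableOn).symm
    _ = _ := by
        refine setIntegral_congr_ae (ℱ.le t _ hE) ?_
        filter_upwards [halg.randomize t ht] with ω hω hωE
        have h1 : (μ[I | pastAndAdvice ℱ Z t]) ω = 1 - 1 / 2 * Real.exp (-(x ω * sgn (x ω))) :=
          hω (hEr ω hωE)
        rw [h1]
        change _ = gapError (y t) (x ω)
        simp only [b, a, gapError]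
        split_ifs <;> ring

lemma setIntegral_error_le_errorBound (hprot : IsProtocol μ ℱ T p y c Z yhat)
    (halg : IsLCBGaptron μ ℱ T C lam β δ y c Z yhat) (hy : ∀ t, y t = 1 ∨ y t = -1) {t : ℕ}
    (ht : t ∈ Finset.Icc 1 T) (hCt : C.card < t) {G : Set Ω} (hG : MeasurableSet[ℱ t] G) :
    ∫ ω in G, (if yhat t ω ≠ y t then (1 : ℝ) else 0) ∂μ ≤
      ∫ ω in G, errorBound (y t) β (fun j => numPaid (fun s => c s ω) t j (c t ω j))
        (fun j => phat (fun s => c s ω) (fun s => Z s ω) y t j (c t ω j)) (Z t ω) ∂μ := by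
  set n : Ω → Fin K → ℕ := fun ω j => numPaid (fun s => c s ω) t j (c t ω j) with hn_def
  set q : Ω → Fin K → ℝ := fun ω j => phat (fun s => c s ω) (fun s => Z s ω) y t j (c t ω j)
    with hq_def
  have hn := measurable_count hprot ht
  have hq := measurable_estimate hprot ht
  have hpos : ∀ ω j, 0 < n ω j := fun ω j =>
    numPaid_pos halg ht hCt ω j (halg.payment_mem t ht ω j)
  have hZm : Measurable (Z t) := (hprot.advice_measurable t ht).mono (ℱ.le _) le_rfl
  have hfm : Measurable fun ω => errorBound (y t) β (n ω) (q ω) (Z t ω) :=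
    measurable_errorBound (y t) β (fun j => (hn j).mono (ℱ.le t) le_rfl)
      (fun j => (hq j).mono (ℱ.le t) le_rfl) hZm
  have hfi : Integrable (fun ω => errorBound (y t) β (n ω) (q ω) (Z t ω)) μ :=
    Integrable.of_bound (C := K + 1) hfm.aestronglyMeasurable
      (Filter.Eventually.of_forall fun ω => by
        rw [Real.norm_of_nonneg (errorBound_nonneg _ _ _ _ _)]
        exact errorBound_le _ _ _ _ _)
  set E : Set Ω := {ω | ∃ j, (n ω j : ℝ) < 2 * β}ᶜ ∩
    {ω | ∀ j, q ω j ∈ Set.Icc (β / n ω j) (1 - β / n ω j)} with hE_def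
  have hE : MeasurableSet[ℱ t] E :=
    MeasurableSet.inter (m := ℱ t) (MeasurableSet.compl (m := ℱ t) (measurableSet_exists_lt hn _))
      (measurableSet_forall_inRange hn hq β)
  have hE' : MeasurableSet E := ℱ.le t _ hE
  have hG' : MeasurableSet G := ℱ.le t _ hG
  have hrange : ∀ ω ∈ E, ∀ j, InRange (fun s => c s ω) (fun s => Z s ω) y β t j := by
    intro ω hω j
    obtain ⟨h1, h2⟩ := hω
    have h1 : ¬ ∃ j, (n ω j : ℝ) < 2 * β := h1
    push Not at h1
    exact (inRange_iff (c := fun s => c s ω) (hpos ω j) (h1 j)).2 (h2 j)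
  have herr := integrable_error hprot ht
  rw [← integral_inter_add_sdiff hE' herr.integrableOn,
    ← integral_inter_add_sdiff hE' hfi.integrableOn]
  refine add_le_add (le_of_eq ?_) ?_
  · rw [setIntegral_error_eq hprot halg hy ht (MeasurableSet.inter (m := ℱ t) hG hE)
      fun ω hω => hrange ω hω.2]
    refine setIntegral_congr_fun (hG'.inter hE') fun ω hω => ?_
    have h1 : ¬ ∃ j, (n ω j : ℝ) < 2 * β := hω.2.1
    have h2 : ∀ j, q ω j ∈ Set.Icc (β / n ω j) (1 - β / n ω j) := hω.2.2
    simp only [errorBound]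
    rw [if_neg h1, if_pos h2]
    rfl
  · refine setIntegral_mono_on herr.integrableOn hfi.integrableOn (hG'.diff hE') fun ω hω => ?_
    have hle : (if yhat t ω ≠ y t then (1 : ℝ) else 0) ≤ 1 := by split_ifs <;> norm_num
    simp only [errorBound]
    by_cases h1 : ∃ j, (n ω j : ℝ) < 2 * β
    · rwa [if_pos h1]
    have h2 : ¬ ∀ j, q ω j ∈ Set.Icc (β / n ω j) (1 - β / n ω j) := fun h => hω.2 ⟨h1, h⟩
    rw [if_neg h1, if_neg h2]
    push Not at h1
    have hiff := fun j => inRange_iff (c := fun s => c s ω) (Z := fun s => Z s ω) (y := y)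
      (hpos ω j) (h1 j)
    push Not at h2
    obtain ⟨i, hi⟩ := h2
    obtain ⟨j, hj, hpred⟩ := halg.follow t ht ω ⟨i, fun h => hi ((hiff i).1 h)⟩
    have hj' : q ω j ∉ Set.Icc (β / n ω j) (1 - β / n ω j) := fun h => hj ((hiff j).2 h)
    refine le_trans ?_ (Finset.single_le_sum (fun j _ => ?_) (Finset.mem_univ j))
    · rw [if_neg hj']
      by_cases h3 : yhat t ω = y t
      · have h4 : sgn (q ω j - 1 / 2) * Z t ω j = y t := by rw [← h3, hpred]
        rw [if_pos h4, if_neg (not_not.2 h3)]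
      · have h4 : ¬ sgn (q ω j - 1 / 2) * Z t ω j = y t := by rw [← hpred]; exact h3
        rw [if_neg h4]
        exact hle
    · split_ifs <;> norm_num

lemma integrable_sum_payment (hprot : IsProtocol μ ℱ T p y c Z yhat)
    (halg : IsLCBGaptron μ ℱ T C lam β δ y c Z yhat) (hC : ∀ a ∈ C, a ∈ Set.Icc (0 : ℝ) 1) {t : ℕ}
    (ht : t ∈ Finset.Icc 1 T) : Integrable (fun ω => lam * ∑ j, c t ω j) μ := by
  refine Integrable.const_mul (integrable_finsetSum _ fun j _ => ?_) _
  refine Integrable.of_bound (C := 1) ?_ (Filter.Eventually.of_forall fun ω => ?_)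
  · exact ((measurable_pi_apply j).comp ((hprot.payment_measurable t ht).mono (ℱ.le t)
      le_rfl)).aestronglyMeasurable
  · have := hC _ (halg.payment_mem t ht ω j)
    rw [Real.norm_of_nonneg this.1]
    exact this.2

lemma integrable_sum_inv_numPaid (hprot : IsProtocol μ ℱ T p y c Z yhat) {t : ℕ}
    (ht : t ∈ Finset.Icc 1 T) :
    Integrable (fun ω => ∑ j, (numPaid (fun s => c s ω) t j (c t ω j) : ℝ)⁻¹) μ := by
  refine integrable_finsetSum _ fun j _ => ?_
  refine Integrable.of_bound (C := 1) ?_ (Filter.Eventually.of_forall fun ω => ?_)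
  · exact (Measurable.inv (measurable_from_top.comp
      ((measurable_count hprot ht j).mono (ℱ.le t) le_rfl))).aestronglyMeasurable
  · rw [Real.norm_of_nonneg (by positivity)]
    exact Nat.cast_inv_le_one _

/-- The expected cost of a round after the exploration phase. -/
lemma integral_cost_le (hprot : IsProtocol μ ℱ T p y c Z yhat)
    (halg : IsLCBGaptron μ ℱ T C lam β δ y c Z yhat) (hlam : 0 < lam)
    (hy : ∀ t, y t = 1 ∨ y t = -1)
    (hℓ : 0 < Real.log (3 / δ)) (hβ : β = 18 * Real.log (3 / δ) * (K : ℝ) ^ 2)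
    (hC : ∀ a ∈ C, a ∈ Set.Icc (0 : ℝ) 1)
    (hp : ∀ j, ∀ a ∈ C, p j a ∈ Set.Icc (0 : ℝ) 1) {t : ℕ}
    (ht : t ∈ Finset.Icc 1 T) (hCt : C.card < t) {a : Fin K → ℝ} (ha : ∀ j, a j ∈ C) :
    ∫ ω, ((if yhat t ω ≠ y t then (1 : ℝ) else 0) + lam * ∑ j, c t ω j) ∂μ ≤
      Phi (fun j => p j (a j)) + lam * ∑ j, a j +
        (1 + lam * K) * μ.real (goodEvent C (Real.log (3 / δ)) p y c Z t)ᶜ +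
        (2 * β + 4 * Real.log (3 / δ)) *
          ∫ ω, ∑ j, (numPaid (fun s => c s ω) t j (c t ω j) : ℝ)⁻¹ ∂μ := by
  have ht' : t ≤ T + 1 := by linarith [Finset.mem_Icc.1 ht]
  have hβ0 : 0 ≤ β := by rw [hβ]; positivity
  set G := goodEvent C (Real.log (3 / δ)) p y c Z t with hG_def
  have hG : MeasurableSet[ℱ t] G := measurableSet_goodEvent (m := ℱ t)
    (hprot.measurable_payment ht') (hprot.measurable_advice ht') C _ p
  have hG' : MeasurableSet G := ℱ.le t _ hG
  have herr := integrable_error hprot ht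
  have hpay := integrable_sum_payment hprot halg hC ht
  have hinv := integrable_sum_inv_numPaid hprot ht
  have hcost : Integrable
      (fun ω => (if yhat t ω ≠ y t then (1 : ℝ) else 0) + lam * ∑ j, c t ω j) μ := herr.add hpay
  set M := Phi (fun j => p j (a j)) + lam * ∑ j, a j with hM_def
  have hM : 0 ≤ M := by
    have h1 : 0 ≤ ∑ j, a j := Finset.sum_nonneg fun j _ => (hC _ (ha j)).1
    have h2 := Phi_nonneg fun j => p j (a j)
    positivity
  set κ := 2 * β + 4 * Real.log (3 / δ) with hκ_def
  have hκ : 0 ≤ κ := by positivity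
  set r : Ω → ℝ := fun ω => ∑ j, (numPaid (fun s => c s ω) t j (c t ω j) : ℝ)⁻¹ with hr_def
  have hr0 : ∀ ω, 0 ≤ r ω := fun ω => Finset.sum_nonneg fun j _ => by positivity
  have hgi : Integrable (fun ω => M - lam * ∑ j, c t ω j + κ * r ω) μ :=
    ((integrable_const M).sub hpay).add (hinv.const_mul κ)
  have hround : ∫ ω in G, (if yhat t ω ≠ y t then (1 : ℝ) else 0) ∂μ ≤
      ∫ ω in G, (M - lam * ∑ j, c t ω j + κ * r ω) ∂μ := by
    refine (setIntegral_error_le_errorBound hprot halg hy ht hCt hG).trans ?_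
    rw [← integral_indicator hG', ← integral_indicator hG']
    refine hprot.integral_advice_le ht
      (f := fun z => G.indicator fun ω => errorBound (y t) β
        (fun j => numPaid (fun s => c s ω) t j (c t ω j))
        (fun j => phat (fun s => c s ω) (fun s => Z s ω) y t j (c t ω j)) z)
      (b := K + 1) (fun z => ?_) (fun z ω => ?_) (hgi.indicator hG') (fun ω => ?_)
    · exact (measurable_errorBound (m := ℱ t) (y t) β (measurable_count hprot ht)
        (measurable_estimate hprot ht) measurable_const).indicator hG
    · by_cases hω : ω ∈ G
      · rw [Set.indicator_of_mem hω, abs_of_nonneg (errorBound_nonneg _ _ _ _ _)]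
        exact errorBound_le _ _ _ _ _
      · rw [Set.indicator_of_notMem hω, abs_zero]
        positivity
    · by_cases hω : ω ∈ G
      · simp only [Set.indicator_of_mem hω]
        exact sum_errorBound_le_of_goodEvent hprot halg hy hℓ hβ hp ht hCt hω ha
      · simp only [Set.indicator_of_notMem hω, zero_mul, Finset.sum_const_zero, le_refl]
  have hgood : ∫ ω in G, ((if yhat t ω ≠ y t then (1 : ℝ) else 0) + lam * ∑ j, c t ω j) ∂μ ≤
      M + κ * ∫ ω, r ω ∂μ := by
    calc _ = ∫ ω in G, (if yhat t ω ≠ y t then (1 : ℝ) else 0) ∂μ +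
          ∫ ω in G, lam * ∑ j, c t ω j ∂μ := integral_add herr.integrableOn hpay.integrableOn
      _ ≤ ∫ ω in G, (M - lam * ∑ j, c t ω j + κ * r ω) ∂μ +
          ∫ ω in G, lam * ∑ j, c t ω j ∂μ := by gcongr
      _ = ∫ ω in G, (M + κ * r ω) ∂μ := by
          rw [← integral_add hgi.integrableOn hpay.integrableOn]
          congr 1
          funext ω
          ring
      _ ≤ ∫ ω, (M + κ * r ω) ∂μ :=
          setIntegral_le_integral ((integrable_const M).add (hinv.const_mul κ))
            (Filter.Eventually.of_forall fun ω =>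
              add_nonneg hM (mul_nonneg hκ (hr0 ω)))
      _ = M + κ * ∫ ω, r ω ∂μ := by
          rw [integral_add (integrable_const M) (hinv.const_mul κ), integral_const_mul]
          simp
  have hbad : ∫ ω in Gᶜ, ((if yhat t ω ≠ y t then (1 : ℝ) else 0) + lam * ∑ j, c t ω j) ∂μ ≤
      (1 + lam * K) * μ.real Gᶜ := by
    calc _ ≤ ∫ _ω in Gᶜ, (1 + lam * K) ∂μ :=
          setIntegral_mono hcost.integrableOn (integrable_const _).integrableOn
            fun ω => cost_le halg hlam hC ht ω
      _ = _ := by simp [mul_comm]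
  rw [← integral_add_compl hG' hcost]
  linarith

end Rounds

end PaidExperts

theorem mainTheorem2 {Ω : Type*} {mΩ : MeasurableSpace Ω} (μ : Measure Ω)
    [IsProbabilityMeasure μ] (ℱ : Filtration ℕ mΩ)
    (K T : ℕ) (lam L ε δ β : ℝ) (hlam : 0 < lam) (hδ : δ ∈ Set.Ioo (0 : ℝ) 1)
    (hβ : β = 18 * Real.log (3 / δ) * (K : ℝ) ^ 2)
    (p : Fin K → ℝ → ℝ)
    (hp : ∀ j, ∀ a ∈ Set.Icc (0 : ℝ) 1, p j a ∈ Set.Icc (0 : ℝ) 1)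
    (hpL : ∀ j, ∀ a ∈ Set.Icc (0 : ℝ) 1, ∀ b ∈ Set.Icc (0 : ℝ) 1,
      |p j a - p j b| ≤ L * |a - b|)
    (C : Finset ℝ) (hC : ∀ a ∈ C, a ∈ Set.Icc (0 : ℝ) 1)
    (hCε : ∀ a ∈ Set.Icc (0 : ℝ) 1, ∃ b ∈ C, |b - a| ≤ ε)
    (y : ℕ → ℝ) (hy : ∀ t, y t = 1 ∨ y t = -1)
    (c Z : ℕ → Ω → Fin K → ℝ) (yhat : ℕ → Ω → ℝ)
    (hprot : PaidExperts.IsProtocol μ ℱ T p y c Z yhat)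
    (halg : PaidExperts.IsLCBGaptron μ ℱ T C lam β δ y c Z yhat) :
    IsLeast (PaidExperts.objectiveValues lam p) (PaidExperts.opt lam p) ∧
    PaidExperts.expectedCost μ T lam y c yhat ≤
      T * PaidExperts.opt lam p
      + (1 + lam * K) * (T : ℝ) ^ 3 * K * δ
      + T * (4 * L + lam) * K * ε
      + (C.card : ℝ) *
        (1 + lam * K + 2592 * (K : ℝ) ^ 2 * (Real.log (3 / δ)) ^ 2
          + (1 + Real.log T) *
            (K * (2 * β + 4 * Real.log (3 / δ)) + 576 * (K : ℝ) ^ 2 * Real.log (3 / δ))) := by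
  refine ⟨PaidExperts.isLeast_opt hpL, ?_⟩
  obtain ⟨hδ0, hδ1⟩ := hδ
  set ℓ := Real.log (3 / δ) with hℓ_def
  have hℓ : 0 < ℓ := Real.log_pos (by rw [lt_div_iff₀ hδ0]; linarith)
  have hexp : Real.exp (-ℓ) = δ / 3 := by
    rw [hℓ_def, ← Real.log_inv, Real.exp_log (by positivity), inv_div]
  have hβ0 : 0 ≤ β := by rw [hβ]; positivity
  obtain ⟨a, ha, haM⟩ := PaidExperts.exists_grid_le hlam hp hpL hC hCε
  set M := PaidExperts.Phi (fun j => p j (a j)) + lam * ∑ j, a j with hM_def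
  have hM : 0 ≤ M := by
    have h1 : 0 ≤ ∑ j, a j := Finset.sum_nonneg fun j _ => (hC _ (ha j)).1
    have h2 := PaidExperts.Phi_nonneg fun j => p j (a j)
    positivity
  set κ := 2 * β + 4 * ℓ with hκ_def
  have hκ : 0 ≤ κ := by positivity
  let r : ℕ → Ω → ℝ := fun t ω =>
    ∑ j, (PaidExperts.numPaid (fun s => c s ω) t j (c t ω j) : ℝ)⁻¹
  have hr0 : ∀ t ω, 0 ≤ r t ω := fun t ω => Finset.sum_nonneg fun j _ => by positivity
  have hround : ∀ t ∈ Finset.Icc 1 T,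
      ∫ ω, ((if yhat t ω ≠ y t then (1 : ℝ) else 0) + lam * ∑ j, c t ω j) ∂μ ≤
        (if t ≤ C.card then 1 + lam * K else 0) + M + (1 + lam * K) * ((T : ℝ) ^ 2 * K * δ) +
          κ * ∫ ω, r t ω ∂μ := by
    intro t ht
    have hI : 0 ≤ κ * ∫ ω, r t ω ∂μ := mul_nonneg hκ (integral_nonneg (hr0 t))
    have hD : 0 ≤ (1 + lam * K) * ((T : ℝ) ^ 2 * K * δ) := by positivity
    by_cases htC : t ≤ C.card
    · rw [if_pos htC]
      have h1 : ∫ ω, ((if yhat t ω ≠ y t then (1 : ℝ) else 0) + lam * ∑ j, c t ω j) ∂μ ≤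
          ∫ _ω, (1 + lam * K) ∂μ :=
        integral_mono ((PaidExperts.integrable_error hprot ht).add
          (PaidExperts.integrable_sum_payment hprot halg hC ht)) (integrable_const _)
          fun ω => PaidExperts.cost_le halg hlam hC ht ω
      simp only [integral_const, probReal_univ, smul_eq_mul, one_mul] at h1
      linarith
    · rw [if_neg htC, zero_add]
      have hpC : ∀ j, ∀ a ∈ C, p j a ∈ Set.Icc (0 : ℝ) 1 := fun j a ha => hp j a (hC a ha)
      have h1 := PaidExperts.integral_cost_le hprot halg hlam hy hℓ hβ hC hpC ht (not_le.1 htC) ha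
      have h2 := hprot.measure_compl_goodEvent_le hy hℓ hpC ht
      have h3 : (K : ℝ) * C.card * T * (2 * Real.exp (-ℓ)) ≤ (T : ℝ) ^ 2 * K * δ := by
        rw [hexp]
        have hCT : (C.card : ℝ) ≤ T := by
          have := (Finset.mem_Icc.1 ht).2
          exact_mod_cast (by omega : C.card ≤ T)
        calc (K : ℝ) * C.card * T * (2 * (δ / 3)) ≤ (K : ℝ) * T * T * δ := by
              gcongr
              linarith
          _ = _ := by ring
      have h4 := mul_le_mul_of_nonneg_left (h2.trans h3) (show 0 ≤ 1 + lam * (K : ℝ) by positivity)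
      linarith
  have hlog : ∑ t ∈ Finset.Icc 1 T, ∫ ω, r t ω ∂μ ≤ K * (C.card * (1 + Real.log T)) := by
    rw [← integral_finsetSum _ fun t ht => PaidExperts.integrable_sum_inv_numPaid hprot ht]
    calc _ ≤ ∫ _ω, (K : ℝ) * (C.card * (1 + Real.log T)) ∂μ := by
          refine integral_mono (integrable_finsetSum _ fun t ht =>
            PaidExperts.integrable_sum_inv_numPaid hprot ht) (integrable_const _) fun ω => ?_
          beta_reduce
          rw [Finset.sum_comm]
          calc _ ≤ ∑ _j : Fin K, (C.card : ℝ) * (1 + Real.log T) :=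
                Finset.sum_le_sum fun j _ => PaidExperts.sum_inv_numPaid_le (fun s => c s ω) j
                  fun t ht => halg.payment_mem t ht ω j
            _ = _ := by simp
      _ = _ := by simp
  have hexplore : ∑ t ∈ Finset.Icc 1 T, (if t ≤ C.card then 1 + lam * (K : ℝ) else 0) ≤
      C.card * (1 + lam * K) := by
    rw [← Finset.sum_filter, Finset.sum_const, nsmul_eq_mul]
    gcongr
    calc _ ≤ (Finset.Icc 1 C.card).card := Finset.card_le_card fun t ht => by
          simp only [Finset.mem_filter, Finset.mem_Icc] at ht ⊢
          omega
      _ = C.card := by simp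
  have htotal := Finset.sum_le_sum hround
  simp only [Finset.sum_add_distrib, ← Finset.mul_sum, Finset.sum_const, Nat.card_Icc,
    Nat.add_sub_cancel, nsmul_eq_mul] at htotal
  have hlog' := mul_le_mul_of_nonneg_left hlog hκ
  have hTM := mul_le_mul_of_nonneg_left haM (Nat.cast_nonneg (α := ℝ) T)
  have hlogT : 0 ≤ Real.log T := Real.log_natCast_nonneg T
  have hslack : 0 ≤ (C.card : ℝ) * (2592 * (K : ℝ) ^ 2 * ℓ ^ 2 +
      (1 + Real.log T) * (576 * (K : ℝ) ^ 2 * ℓ)) := by positivity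
  unfold PaidExperts.expectedCost
  linarith
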